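/- Let $N>2$, let $a_1<a_2<\dots<a_N$ be real numbers, and let $A$ be a real symmetric $N\times N$ matrix with spectrum $\{a_1,\dots,a_N\}$ (for instance $A=\mathrm{diag}(a_1,\dots,a_N)$). The real numerical shadow $\mathcal P^{\mathbb R}_A$ of $A$ is the law of $\langle u|A|u\rangle$, where $u$ is uniformly distributed on the unit sphere of $\mathbb R^N$. For $k_1,\dots,k_N>0$, $\mathcal D(a_1,\dots,a_N;k_1,\dots,k_N)$ denotes the law of $\sum_{i=1}^N a_iT_i$, where $T_N=1-\sum_{i<N}T_i$ and $(T_1,\dots,T_{N-1})$ has the Dirichlet distribution, that is, has the density $$\frac{\Gamma(\sum_{i=1}^N k_i)}{\prod_{i=1}^N\Gamma(k_i)}\prod_{i=1}^{N-1}t_i^{k_i-1}\Bigl(1-\sum_{i=1}^{N-1}t_i\Bigr)^{k_N-1}$$ on the simplex $\{t\in\mathbb R^{N-1}: t_i\ge 0,\ \sum_{i=1}^{N-1} t_i\le 1\}$. For $0\le j\le\lfloor\frac{N-2}{2}\rfloor$ put $$g_j(s)=\prod_{m=0}^{2j}(a_{N-m}-s)^{-1/2}\prod_{m=2j+1}^{N-1}(s-a_{N-m})^{-1/2}.$$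 Define $f:\mathbb R\to\mathbb R$ as follows. If $a_{N-2M}\le x<a_{N-2M+1}$ with $1\le M\le\frac{N-1}{2}$, then $$f(x)=\frac{N-2}{2\pi}\sum_{j=0}^{M-1}(-1)^j\int_{a_{N-2j-1}}^{a_{N-2j}}g_j(s)(s-x)^{\frac N2-2}\,ds.$$ If $a_{N-2M-1}\le x<a_{N-2M}$ with $0\le M\le\frac{N-2}{2}$, then $$f(x)=\frac{N-2}{2\pi}\sum_{j=0}^{M-1}(-1)^j\int_{a_{N-2j-1}}^{a_{N-2j}}g_j(s)(s-x)^{\frac N2-2}\,ds+(-1)^M\frac{N-2}{2\pi}\int_x^{a_{N-2M}}g_M(s)(s-x)^{\frac N2-2}\,ds.$$ Outside $[a_1,a_N)$ let $f(x)=0$. All these integrals converge absolutely, except for the integral in $f(a_2)$ when $N=3$; the value of $f$ at that single point is irrelevant. Then $$\mathcal P^{\mathbb R}_A=\mathcal D\bigl(a_1,\dots,a_N;\tfrac12,\dots,\tfrac12\bigr),$$ and $f$ is the probability density of this distribution: $f$ is Lebesgue integrable, $f\ge 0$ almost everywhere, and $\mathcal P^{\mathbb R}_A(B)=\int_B f(x)\,dx$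 for every Borel set $B\subseteq\mathbb R$. -/

import Mathlib

open MeasureTheory

/-- The rotation-invariant probability measure on the unit sphere of Euclidean `ℝ^N`
(normalized surface measure). -/
noncomputable def sphereUniform (N : ℕ) :
    Measure (Metric.sphere (0 : EuclideanSpace ℝ (Fin N)) 1) :=
  ((volume : Measure (EuclideanSpace ℝ (Fin N))).toSphere Set.univ)⁻¹ •
    (volume : Measure (EuclideanSpace ℝ (Fin N))).toSphere

/-- The real numerical shadow of a real matrix `A`: the law of `⟨u|A|u⟩` where `u` is uniformly
distributed on the unit sphere of `ℝ^N`. -/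
noncomputable def realShadow {N : ℕ} (A : Matrix (Fin N) (Fin N) ℝ) : Measure ℝ :=
  (sphereUniform N).map fun u =>
    dotProduct (WithLp.ofLp u.1) (A.mulVec (WithLp.ofLp u.1))

/-- The unit simplex `{t ∈ ℝ^(N-1) : tᵢ ≥ 0, ∑ tᵢ ≤ 1}`. -/
def unitSimplex (N : ℕ) : Set (Fin (N - 1) → ℝ) :=
  {t | (∀ i, 0 ≤ t i) ∧ ∑ i, t i ≤ 1}

/-- The `N` components `(T₁, …, T_N)` belonging to `t ∈ ℝ^(N-1)`: the coordinates of `t`,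
followed by `T_N = 1 - ∑ tᵢ`. -/
noncomputable def components {N : ℕ} (t : Fin (N - 1) → ℝ) (i : Fin N) : ℝ :=
  if h : (i : ℕ) < N - 1 then t ⟨i, h⟩ else 1 - ∑ j, t j

/-- The Dirichlet distribution with parameters `k₁, …, k_N`, as a measure on `ℝ^(N-1)` carried by
the unit simplex. -/
noncomputable def dirichletMeasure {N : ℕ} (k : Fin N → ℝ) : Measure (Fin (N - 1) → ℝ) :=
  (volume.restrict (unitSimplex N)).withDensity fun t =>
    ENNReal.ofReal (Real.Gamma (∑ i, k i) / (∏ i, Real.Gamma (k i)) *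
      ∏ i, components t i ^ (k i - 1))

/-- The distribution `𝒟(a₁, …, a_N; k₁, …, k_N)` of the weighted average `∑ aᵢ Tᵢ`, where
`(T₁, …, T_N)` has the Dirichlet distribution with parameters `k`. -/
noncomputable def dirichletAverage {N : ℕ} (a k : Fin N → ℝ) : Measure ℝ :=
  (dirichletMeasure k).map fun t => ∑ i, a i * components t i

/-- The real function `f` is a probability density, with respect to Lebesgue measure, of the
measure `μ` on `ℝ`. -/
structure IsDensityOf (f : ℝ → ℝ) (μ : Measure ℝ) : Prop where
  integrable : Integrable f
  nonneg : ∀ᵐ x, 0 ≤ f x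
  eq_withDensity : μ = volume.withDensity fun x => ENNReal.ofReal (f x)

/-- The knot `a_i`, numbered from `1` to `N` (the value for other `i` is never used). -/
noncomputable def knot {N : ℕ} (a : Fin N → ℝ) (i : ℕ) : ℝ :=
  if h : 1 ≤ i ∧ i ≤ N then a ⟨i - 1, by omega⟩ else 0

/-- `g_j(s) = ∏_{m=0}^{2j} (a_{N-m} - s)^{-1/2} ∏_{m=2j+1}^{N-1} (s - a_{N-m})^{-1/2}`. -/
noncomputable def shadowKernel {N : ℕ} (a : Fin N → ℝ) (j : ℕ) (s : ℝ) : ℝ :=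
  (∏ m ∈ Finset.Icc 0 (2 * j), (knot a (N - m) - s) ^ (-(1 / 2) : ℝ)) *
    ∏ m ∈ Finset.Icc (2 * j + 1) (N - 1), (s - knot a (N - m)) ^ (-(1 / 2) : ℝ)

/-- The integrand `g_j(s) (s - x)^{N/2 - 2}`. -/
noncomputable def shadowIntegrand {N : ℕ} (a : Fin N → ℝ) (j : ℕ) (x s : ℝ) : ℝ :=
  shadowKernel a j s * (s - x) ^ ((N : ℝ) / 2 - 2)

/-- The formula for the density on `[a_{N-2M}, a_{N-2M+1})`. -/
noncomputable def evenFormula {N : ℕ} (a : Fin N → ℝ) (M : ℕ) (x : ℝ) : ℝ :=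
  ((N : ℝ) - 2) / (2 * Real.pi) * ∑ j ∈ Finset.range M, (-1) ^ j *
    ∫ s in knot a (N - 2 * j - 1)..knot a (N - 2 * j), shadowIntegrand a j x s

/-- The formula for the density on `[a_{N-2M-1}, a_{N-2M})`. -/
noncomputable def oddFormula {N : ℕ} (a : Fin N → ℝ) (M : ℕ) (x : ℝ) : ℝ :=
  ((N : ℝ) - 2) / (2 * Real.pi) * ∑ j ∈ Finset.range M, (-1) ^ j *
    (∫ s in knot a (N - 2 * j - 1)..knot a (N - 2 * j), shadowIntegrand a j x s) +
  (-1) ^ M * (((N : ℝ) - 2) / (2 * Real.pi)) *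
    ∫ s in x..knot a (N - 2 * M), shadowIntegrand a M x s

/-- The piecewise function given by `evenFormula` on `[a_{N-2M}, a_{N-2M+1})`,
`1 ≤ M ≤ (N-1)/2`, by `oddFormula` on `[a_{N-2M-1}, a_{N-2M})`, `0 ≤ M ≤ (N-2)/2`, and by `0`
outside `[a_1, a_N)`. These intervals are disjoint, so at most one summand is nonzero. -/
noncomputable def shadowDensity {N : ℕ} (a : Fin N → ℝ) (x : ℝ) : ℝ :=
  (∑ M ∈ Finset.Icc 1 ((N - 1) / 2),
    (Set.Ico (knot a (N - 2 * M)) (knot a (N - 2 * M + 1))).indicator (evenFormula a M) x) +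
  ∑ M ∈ Finset.Icc 0 ((N - 2) / 2),
    (Set.Ico (knot a (N - 2 * M - 1)) (knot a (N - 2 * M))).indicator (oddFormula a M) x

/-! The proof compares generalized Stieltjes transforms `z ↦ ∫ (z - x)^(-N/2) dμ(x)` for `z > a_N`.
Such a transform determines a finite measure on a compact interval
(`measure_eq_of_integral_rpow_sub_eq`): differentiating in `z` raises the exponent by integers, so
at one fixed `z` the integrals of `(z - x)^(-p)` times any polynomial in `1/(z - x)` are known, and
Weierstrass approximation applies. The shadow, the Dirichlet average and `f` all have transform `∏
(z - a_i)^(-1/2)`.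

For the shadow, a Gaussian integral of the quadratic form with coefficients `z - a_i` is computed in
Cartesian and in polar coordinates (`lintegral_sphereUniform_quadratic`). For the Dirichlet law, a
product of Gamma densities is integrated in the coordinates "sum, point of the simplex"
(`lintegral_dirichletMeasure`).

For `f`, put `q = N/2 - 1` and `α = a_1`. On `x ≥ α`, `f` is a signed sum of fractional integrals
`∫_{s > x} g_j(s) (s - x)^(q-1) ds`, with `s` in the `j`-th interval (`shadowDensity_eq_sum`).
Fubini and the elementary integral of `(s - x)^(q-1) (z - x)^(-q-1)` over `[α, s)` reduce the
transform of `f` to a multiple of `∑ (-1)^j ∫ g_j(s) (s - α)^q / (z - s) ds`. Let `h(w) = (w - α)^q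
∏ (w - a_i)^(-1/2)` in the upper half-plane. It is real beyond `a_N`, and on `(a_1, a_N)` it
acquires a factor `-i` at each knot passed to the left, so its boundary values are alternately
imaginary and real there; left of `a_1` the total phase is `-1`. Hence the sum is the Cauchy
transform of `Im h`, and as `h(w) = O(1/|w|)`, Cauchy's formula (`integral_im_branchKernel_div`)
gives `π h(z)`.

Nonnegativity of `f` need not be seen from the formula. Uniqueness gives `μ + f⁻dx = f⁺dx`; as
`f⁺dx` and `f⁻dx` live on disjoint sets, `f⁻ = 0` almost everywhere
(`isDensityOf_of_integral_rpow_sub`). -/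

section ShadowDensity

open Set Filter Topology

/-! ### Uniqueness for generalized Stieltjes transforms. -/

/-- A bounded-below kernel `(z - x)^(-p)` is integrable against a finite measure carried by
`[a, b]` when `z > b`. -/
lemma integrable_rpow_sub_of_ae_mem_Icc {μ : Measure ℝ} [IsFiniteMeasure μ] {a b : ℝ}
    (hμ : ∀ᵐ x ∂μ, x ∈ Icc a b) {p z : ℝ} (hp : 0 ≤ p) (hz : b < z) :
    Integrable (fun x => (z - x) ^ (-p)) μ := by
  refine Integrable.of_bound (by fun_prop : Measurable _).aestronglyMeasurable
    ((z - b) ^ (-p)) ?_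
  filter_upwards [hμ] with x hx
  rw [Real.norm_of_nonneg (Real.rpow_nonneg (by linarith [hx.2]) _)]
  exact Real.rpow_le_rpow_of_nonpos (by linarith) (by linarith [hx.2]) (by linarith)

/-- Differentiating in `z` trades the exponent `p` for `p + 1`; iterating this yields all the
exponents `p + n` from one. -/
lemma hasDerivAt_integral_rpow_sub {μ : Measure ℝ} [IsFiniteMeasure μ] {a b : ℝ}
    (hμ : ∀ᵐ x ∂μ, x ∈ Icc a b) {p z : ℝ} (hp : 0 ≤ p) (hz : b < z) :
    HasDerivAt (fun z => ∫ x, (z - x) ^ (-p) ∂μ) (∫ x, (-p) * (z - x) ^ (-(p + 1)) ∂μ) z := by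
  -- On the neighbourhood `(c, ∞)` of `z` the base stays at least `c - b > 0`, which bounds the
  -- derivative uniformly.
  obtain ⟨c, hbc, hcz⟩ := exists_between hz
  refine (hasDerivAt_integral_of_dominated_loc_of_deriv_le
    (F' := fun z x => (-p) * (z - x) ^ (-(p + 1)))
    (bound := fun _ => p * (c - b) ^ (-(p + 1))) (Ioi_mem_nhds hcz)
    (Eventually.of_forall fun y => (by fun_prop : Measurable _).aestronglyMeasurable)
    (integrable_rpow_sub_of_ae_mem_Icc hμ hp hz)
    (by fun_prop : Measurable _).aestronglyMeasurable ?_ (integrable_const _) ?_).2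
  · filter_upwards [hμ] with x hx y hy
    have hy : c < y := hy
    rw [norm_mul, norm_neg, Real.norm_of_nonneg hp,
      Real.norm_of_nonneg (Real.rpow_nonneg (by linarith [hx.2]) _)]
    exact mul_le_mul_of_nonneg_left
      (Real.rpow_le_rpow_of_nonpos (by linarith) (by linarith [hx.2]) (by linarith)) hp
  · filter_upwards [hμ] with x hx y hy
    have hy : c < y := hy
    have h := ((hasDerivAt_id y).sub_const x).rpow_const (p := -p)
      (Or.inl (by simp only [id]; linarith [hx.2]))
    refine h.congr_deriv ?_
    rw [show -(p + 1) = -p - 1 by ring, one_mul]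
    rfl

/-- The transforms of order `p + n` are determined by the transform of order `p`. -/
lemma integral_rpow_sub_eq_of_forall {μ ν : Measure ℝ} [IsFiniteMeasure μ] [IsFiniteMeasure ν]
    {a b : ℝ} (hμ : ∀ᵐ x ∂μ, x ∈ Icc a b) (hν : ∀ᵐ x ∂ν, x ∈ Icc a b) {p : ℝ} (hp : 0 < p)
    (h : ∀ z, b < z → ∫ x, (z - x) ^ (-p) ∂μ = ∫ x, (z - x) ^ (-p) ∂ν) (n : ℕ) :
    ∀ z, b < z → ∫ x, (z - x) ^ (-(p + n)) ∂μ = ∫ x, (z - x) ^ (-(p + n)) ∂ν := by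
  induction n with
  | zero => simpa using h
  | succ n ih =>
    intro z hz
    have hpn : 0 < p + n := by positivity
    have h1 := hasDerivAt_integral_rpow_sub hμ hpn.le hz
    have h2 := hasDerivAt_integral_rpow_sub hν hpn.le hz
    have h3 := h1.unique (h2.congr_of_eventuallyEq
      (by filter_upwards [Ioi_mem_nhds hz] with y hy using ih y hy))
    rw [integral_const_mul, integral_const_mul] at h3
    have := mul_left_cancel₀ (by linarith : -(p + n) ≠ 0) h3
    push_cast
    rwa [← add_assoc]

/-- A finite measure carried by a compact interval `[a, b]` is determined by its generalized
Stieltjes transform `z ↦ ∫ (z - x)^(-p) dμ(x)` on `(b, ∞)`. -/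
theorem measure_eq_of_integral_rpow_sub_eq {μ ν : Measure ℝ} [IsFiniteMeasure μ]
    [IsFiniteMeasure ν] {a b : ℝ} (hab : a ≤ b) (hμ : ∀ᵐ x ∂μ, x ∈ Icc a b)
    (hν : ∀ᵐ x ∂ν, x ∈ Icc a b) {p : ℝ} (hp : 0 < p)
    (h : ∀ z, b < z → ∫ x, (z - x) ^ (-p) ∂μ = ∫ x, (z - x) ^ (-p) ∂ν) : μ = ν := by
  have hall := integral_rpow_sub_eq_of_forall hμ hν hp h
  refine ext_of_forall_integral_eq_of_IsFiniteMeasure fun g => ?_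
  set z : ℝ := b + 1 with hz
  have hbz : b < z := by linarith
  -- polynomials in `1 / (z - x)` weighted by `(z - x)^(-p)`
  have hterm : ∀ x ∈ Icc a b, ∀ n : ℕ,
      (z - x) ^ (-p) * ((z - x)⁻¹) ^ n = (z - x) ^ (-(p + n)) := by
    intro x hx n
    have hpos : 0 < z - x := by linarith [hx.2]
    rw [neg_add, Real.rpow_add hpos, Real.rpow_neg hpos.le (n : ℝ), Real.rpow_natCast, inv_pow]
  have key : ∀ (m : Measure ℝ) [IsFiniteMeasure m], (∀ᵐ x ∂m, x ∈ Icc a b) →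
      ∀ q : Polynomial ℝ,
      Integrable (fun x => (z - x) ^ (-p) * q.eval ((z - x)⁻¹)) m ∧
      ∫ x, (z - x) ^ (-p) * q.eval ((z - x)⁻¹) ∂m =
        ∑ n ∈ Finset.range (q.natDegree + 1), q.coeff n * ∫ x, (z - x) ^ (-(p + n)) ∂m := by
    intro m _ hm q
    have hae : (fun x => (z - x) ^ (-p) * q.eval ((z - x)⁻¹)) =ᵐ[m]
        fun x => ∑ n ∈ Finset.range (q.natDegree + 1), q.coeff n * (z - x) ^ (-(p + n)) := by
      filter_upwards [hm] with x hx
      rw [Polynomial.eval_eq_sum_range, Finset.mul_sum]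
      refine Finset.sum_congr rfl fun n _ => ?_
      rw [← hterm x hx n]; ring
    have hint : ∀ n ∈ Finset.range (q.natDegree + 1),
        Integrable (fun x => q.coeff n * (z - x) ^ (-(p + n))) m := fun n _ =>
      (integrable_rpow_sub_of_ae_mem_Icc hm (by positivity) hbz).const_mul _
    refine ⟨(integrable_finsetSum _ hint).congr hae.symm, ?_⟩
    rw [integral_congr_ae hae, integral_finsetSum _ hint]
    simp_rw [integral_const_mul]
  set Cμ := ∫ x, (z - x) ^ (-p) ∂μ with hCμ
  set Cν := ∫ x, (z - x) ^ (-p) ∂ν with hCν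
  have hnonneg : ∀ (m : Measure ℝ), (∀ᵐ x ∂m, x ∈ Icc a b) → 0 ≤ ∫ x, (z - x) ^ (-p) ∂m := by
    intro m hm
    refine integral_nonneg_of_ae ?_
    filter_upwards [hm] with x hx using Real.rpow_nonneg (by linarith [hx.2]) _
  -- With `v = 1/(z - x)` this function is `g(x) (z - x)^p`. A polynomial `q(v)` close to it makes
  -- `(z - x)^(-p) q(1/(z - x))` close to `g(x)`.
  have hcont : ContinuousOn (fun v : ℝ => g (z - v⁻¹) * v ^ (-p)) (Icc (z - a)⁻¹ (z - b)⁻¹) := by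
    have hv : ∀ v ∈ Icc (z - a)⁻¹ (z - b)⁻¹, v ≠ 0 := fun v hv =>
      ((inv_pos.2 (by linarith : 0 < z - a)).trans_le hv.1).ne'
    refine ContinuousOn.mul (g.continuous.comp_continuousOn
      (continuousOn_const.sub (continuousOn_id.inv₀ hv))) ?_
    exact continuousOn_id.rpow_const fun v hv' => Or.inl (hv v hv')
  refine eq_of_forall_dist_le fun ε hε => ?_
  -- The errors under `μ` and `ν` are at most the tolerance times `Cμ` and `Cν`; the `+ 1` keeps the
  -- denominator positive.
  obtain ⟨q, hq⟩ := exists_polynomial_near_of_continuousOn _ _ _ hcont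
    (ε / (Cμ + Cν + 1)) (div_pos hε (by linarith [hnonneg μ hμ, hnonneg ν hν]))
  have hbound : ∀ (m : Measure ℝ) [IsFiniteMeasure m], (∀ᵐ x ∂m, x ∈ Icc a b) →
      dist (∫ x, g x ∂m) (∫ x, (z - x) ^ (-p) * q.eval ((z - x)⁻¹) ∂m) ≤
        ε / (Cμ + Cν + 1) * ∫ x, (z - x) ^ (-p) ∂m := by
    intro m _ hm
    rw [dist_eq_norm, ← integral_sub (g.integrable m) (key m hm q).1, ← integral_const_mul]
    refine norm_integral_le_of_norm_le
      ((integrable_rpow_sub_of_ae_mem_Icc hm hp.le hbz).const_mul _) ?_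
    filter_upwards [hm] with x hx
    have hpos : 0 < z - x := by linarith [hx.2]
    have hmem : (z - x)⁻¹ ∈ Icc (z - a)⁻¹ (z - b)⁻¹ :=
      ⟨inv_anti₀ hpos (by linarith [hx.1]), inv_anti₀ (by linarith) (by linarith [hx.2])⟩
    have h1 := (hq _ hmem).le
    rw [inv_inv, sub_sub_cancel, Real.inv_rpow hpos.le, Real.rpow_neg hpos.le, inv_inv] at h1
    have hw : 0 < (z - x) ^ p := Real.rpow_pos_of_pos hpos _
    rw [Real.rpow_neg hpos.le, Real.norm_eq_abs, abs_sub_comm]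
    calc |((z - x) ^ p)⁻¹ * q.eval (z - x)⁻¹ - g x|
        = |q.eval (z - x)⁻¹ - g x * (z - x) ^ p| * ((z - x) ^ p)⁻¹ := by
          rw [← abs_of_pos (inv_pos.2 hw), ← abs_mul, abs_of_pos (inv_pos.2 hw)]
          congr 1
          field_simp
      _ ≤ _ := by gcongr
  have hpoly : ∫ x, (z - x) ^ (-p) * q.eval ((z - x)⁻¹) ∂μ =
      ∫ x, (z - x) ^ (-p) * q.eval ((z - x)⁻¹) ∂ν := by
    rw [(key μ hμ q).2, (key ν hν q).2]
    exact Finset.sum_congr rfl fun n _ => by rw [hall n z hbz]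
  have h1 := hbound μ hμ
  have h2 := hbound ν hν
  rw [dist_comm, ← hpoly] at h2
  refine (dist_triangle _ _ _).trans ((add_le_add h1 h2).trans ?_)
  rw [← mul_add, div_mul_eq_mul_div, div_le_iff₀ (by linarith [hnonneg μ hμ, hnonneg ν hν])]
  exact mul_le_mul_of_nonneg_left (by linarith) hε.le

/-! ### Contour integrals in the upper half-plane. -/

/-- A function that is holomorphic in the upper half-plane and `O(|w|⁻²)` at infinity has
vanishing integrals over horizontal lines. -/
lemma integral_horizontal_eq_zero {Φ : ℂ → ℂ} (hΦ : DifferentiableOn ℂ Φ {w | 0 < w.im})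
    {C R₀ : ℝ} (hdecay : ∀ w : ℂ, 0 < w.im → R₀ ≤ ‖w‖ → ‖Φ w‖ ≤ C / ‖w‖ ^ 2)
    {ε : ℝ} (hε : 0 < ε) (hint : Integrable fun s : ℝ => Φ (s + ε * Complex.I)) :
    ∫ s : ℝ, Φ (s + ε * Complex.I) = 0 := by
  have hC : 0 ≤ C := by
    have h := hdecay (((|R₀| + 1 : ℝ) : ℂ) * Complex.I) (by simp; positivity)
      (by rw [norm_mul, Complex.norm_I, mul_one, Complex.norm_real, Real.norm_eq_abs]
          exact (le_abs_self R₀).trans ((by linarith : |R₀| ≤ |R₀| + 1).trans (le_abs_self _)))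
    by_contra hneg
    push Not at hneg
    refine absurd ((norm_nonneg _).trans h) (not_le.2 (div_neg_of_neg_of_pos hneg ?_))
    rw [norm_mul, Complex.norm_I, mul_one, Complex.norm_real, Real.norm_eq_abs]
    positivity
  refine tendsto_nhds_unique
    (intervalIntegral_tendsto_integral hint tendsto_neg_atTop_atBot tendsto_id) ?_
  -- The contour bounds `[-R, R] × [ε, R]`. Its top and sides have `|w| ≥ R` and contribute at most
  -- `2C/R`, `C/R` and `C/R`.
  have hlim : Tendsto (fun R : ℝ => 4 * C / R) atTop (𝓝 0) :=
    tendsto_const_nhds.div_atTop tendsto_id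
  refine squeeze_zero_norm' ?_ hlim
  filter_upwards [eventually_ge_atTop R₀, eventually_gt_atTop ε] with R hR hRε
  have hR0 : 0 < R := hε.trans hRε
  have hsub : (uIcc (-R + ε * Complex.I : ℂ).re (R + R * Complex.I : ℂ).re ×ℂ
      uIcc (-R + ε * Complex.I : ℂ).im (R + R * Complex.I : ℂ).im) ⊆ {w : ℂ | 0 < w.im} := by
    intro w hw
    have := hw.2
    simp only [mem_preimage, Complex.add_im, Complex.neg_im, Complex.ofReal_im, Complex.mul_im,
      Complex.ofReal_re, Complex.I_im, Complex.I_re, neg_zero, mul_one, mul_zero,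
      add_zero, zero_add, uIcc_of_le hRε.le] at this
    exact hε.trans_le this.1
  have h := Complex.integral_boundary_rect_eq_zero_of_differentiableOn Φ
    (-R + ε * Complex.I) (R + R * Complex.I) (hΦ.mono hsub)
  simp only [Complex.add_im, Complex.neg_im, Complex.ofReal_im, Complex.mul_im,
      Complex.ofReal_re, Complex.I_im, Complex.I_re, neg_zero, mul_one, mul_zero,
      add_zero, zero_add, Complex.add_re, Complex.neg_re, Complex.mul_re, sub_self,
      Complex.ofReal_neg] at h
  have hb : ∀ w : ℂ, 0 < w.im → R ≤ ‖w‖ → ‖Φ w‖ ≤ C / R ^ 2 := fun w h1 h2 =>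
    (hdecay w h1 (hR.trans h2)).trans (by gcongr)
  have htop : ‖∫ x : ℝ in (-R)..R, Φ (x + R * Complex.I)‖ ≤ C / R ^ 2 * |R - (-R)| := by
    refine intervalIntegral.norm_integral_le_of_norm_le_const fun x _ => hb _ (by simpa) ?_
    refine le_trans ?_ (Complex.abs_im_le_norm _)
    simp [abs_of_pos hR0]
  have hside : ∀ c : ℝ, |c| = R →
      ‖∫ y : ℝ in ε..R, Φ (c + y * Complex.I)‖ ≤ C / R ^ 2 * |R - ε| := by
    intro c hc
    refine intervalIntegral.norm_integral_le_of_norm_le_const fun y hy => ?_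
    rw [uIoc_of_le hRε.le] at hy
    refine hb _ (by simpa using hε.trans hy.1) ?_
    refine le_trans ?_ (Complex.abs_re_le_norm _)
    simp [hc]
  have h1 := hside R (abs_of_pos hR0)
  have h2 := hside (-R) (by rw [abs_neg, abs_of_pos hR0])
  push_cast at h2
  have heq : ∫ x : ℝ in (-R)..R, Φ (x + ε * Complex.I) =
      (∫ x : ℝ in (-R)..R, Φ (x + R * Complex.I)) -
      Complex.I • (∫ y : ℝ in ε..R, Φ (R + y * Complex.I)) +
      Complex.I • (∫ y : ℝ in ε..R, Φ (-R + y * Complex.I)) := by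
    linear_combination h
  simp only [id]
  rw [heq]
  refine (norm_add_le _ _).trans ((add_le_add_left (norm_sub_le _ _) _).trans ?_)
  rw [norm_smul, norm_smul, Complex.norm_I, one_mul, one_mul]
  rw [abs_of_pos (by linarith)] at htop
  rw [abs_of_pos (by linarith)] at h1 h2
  have hside' : C / R ^ 2 * (R - ε) ≤ C / R ^ 2 * R := by gcongr; linarith
  calc _ ≤ C / R ^ 2 * (R - -R) + C / R ^ 2 * R + C / R ^ 2 * R := by linarith
    _ = 4 * C / R := by field_simp; ring

/-- A function that is holomorphic in the upper half-plane, `O(|w|⁻²)` at infinity and dominated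
near the real line has boundary values of vanishing integral. -/
theorem integral_boundary_eq_zero {Φ : ℂ → ℂ} (hΦ : DifferentiableOn ℂ Φ {w | 0 < w.im})
    {C R₀ : ℝ} (hdecay : ∀ w : ℂ, 0 < w.im → R₀ ≤ ‖w‖ → ‖Φ w‖ ≤ C / ‖w‖ ^ 2)
    {bound : ℝ → ℝ} (hbound : Integrable bound)
    (hle : ∀ ε : ℝ, 0 < ε → ε ≤ 1 → ∀ᵐ s : ℝ, ‖Φ (s + ε * Complex.I)‖ ≤ bound s)
    (hlim : ∀ᵐ s : ℝ, Tendsto (fun ε : ℝ => Φ (s + ε * Complex.I)) (𝓝[>] 0) (𝓝 (Φ s))) :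
    Integrable (fun s : ℝ => Φ s) ∧ ∫ s : ℝ, Φ s = 0 := by
  have hmeas : ∀ ε : ℝ, 0 < ε → AEStronglyMeasurable (fun s : ℝ => Φ (s + ε * Complex.I)) := by
    intro ε hε
    refine Continuous.aestronglyMeasurable ?_
    refine hΦ.continuousOn.comp_continuous (by fun_prop) fun s => ?_
    simpa using hε
  have hI : Ioc (0 : ℝ) 1 ∈ 𝓝[>] (0 : ℝ) := Ioc_mem_nhdsGT one_pos
  have hint : Integrable fun s : ℝ => Φ s := by
    -- The limit lemma wants measurability for every `ε`, hence the value `0` for `ε ≤ 0`, which the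
    -- filter `𝓝[>] 0` does not see.
    refine hbound.mono' (aestronglyMeasurable_of_tendsto_ae (𝓝[>] (0 : ℝ))
      (f := fun (ε : ℝ) (s : ℝ) => if 0 < ε then Φ (s + ε * Complex.I) else 0) (fun ε => ?_) ?_) ?_
    · split_ifs with hε
      · exact hmeas ε hε
      · exact aestronglyMeasurable_const
    · filter_upwards [hlim] with s hs
      refine hs.congr' ?_
      filter_upwards [self_mem_nhdsWithin] with ε hε
      exact (if_pos (mem_Ioi.1 hε)).symm
    · have hseq : ∀ᵐ s : ℝ, ∀ n : ℕ,
          ‖Φ (s + ((1 / ((n : ℝ) + 1) : ℝ) : ℂ) * Complex.I)‖ ≤ bound s :=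
        ae_all_iff.2 fun n => hle _ (by positivity) (by
          rw [div_le_one (by positivity)]; linarith [(Nat.cast_nonneg n : (0 : ℝ) ≤ n)])
      filter_upwards [hlim, hseq] with s h1 h2
      refine le_of_tendsto (h1.comp (tendsto_nhdsWithin_iff.2
        ⟨tendsto_one_div_add_atTop_nhds_zero_nat (𝕜 := ℝ), Eventually.of_forall fun n => ?_⟩)).norm
        (Eventually.of_forall h2)
      exact mem_Ioi.2 (by positivity)
  refine ⟨hint, ?_⟩
  have h := tendsto_integral_filter_of_dominated_convergence (l := 𝓝[>] (0 : ℝ)) bound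
    (F := fun (ε : ℝ) (s : ℝ) => Φ (s + ε * Complex.I)) (f := fun s : ℝ => Φ s)
    (by filter_upwards [hI] with ε hε using hmeas ε hε.1)
    (by filter_upwards [hI] with ε hε using hle ε hε.1 hε.2) hbound hlim
  refine tendsto_nhds_unique h (tendsto_const_nhds.congr' ?_)
  filter_upwards [hI] with ε hε
  exact (integral_horizontal_eq_zero hΦ hdecay hε.1
    (hbound.mono' (hmeas ε hε.1) (hle ε hε.1 hε.2))).symm

/-! ### Local integrability of products of inverse square roots. -/

section InvSqrt

variable {ι : Type*} [Fintype ι]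

/-- For `y < 0` the real power `y ^ r` is `|y|^r cos (π r)`, which is `0` at `r = -1/2`. So one
summand always vanishes; at `x = 0` all three terms are `0`. -/
lemma abs_rpow_neg_half (x : ℝ) :
    |x| ^ (-(1 / 2) : ℝ) = x ^ (-(1 / 2) : ℝ) + (-x) ^ (-(1 / 2) : ℝ) := by
  have hcos : Real.cos (-(1 / 2) * Real.pi) = 0 := by
    rw [neg_mul, Real.cos_neg, one_div_mul_eq_div, Real.cos_pi_div_two]
  rcases lt_trichotomy x 0 with h | h | h
  · rw [abs_of_neg h, Real.rpow_def_of_neg h, hcos]; simp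
  · subst h; norm_num
  · rw [abs_of_pos h, Real.rpow_def_of_neg (neg_neg_of_pos h), hcos]; simp

lemma locallyIntegrable_abs_sub_rpow (p : ℝ) :
    LocallyIntegrable fun s : ℝ => |s - p| ^ (-(1 / 2) : ℝ) := by
  rw [locallyIntegrable_iff]
  intro K hK
  obtain ⟨r, hr⟩ := hK.isBounded.subset_closedBall 0
  rw [Real.closedBall_eq_Icc] at hr
  refine IntegrableOn.mono_set ?_ (hr.trans (Icc_subset_Icc_right
    (le_max_left _ (0 - r))))
  rw [← intervalIntegrable_iff_integrableOn_Icc_of_le (le_max_right _ _)]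
  simp_rw [abs_rpow_neg_half, neg_sub]
  have hp : ∀ u v, IntervalIntegrable (fun x : ℝ => x ^ (-(1 / 2) : ℝ)) volume u v := fun u v =>
    intervalIntegral.intervalIntegrable_rpow' (by norm_num)
  refine IntervalIntegrable.add ?_ ?_
  · simpa using (hp (0 - r - p) (max (0 + r) (0 - r) - p)).comp_sub_right p
  · simpa using (hp (p - (0 - r)) (p - max (0 + r) (0 - r))).comp_sub_left p

/-- Among products of inverse square roots at distinct knots, one factor dominates. -/
lemma exists_prod_abs_sub_rpow_le_sum {p : ι → ℝ} (hp : Function.Injective p) [Nonempty ι] :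
    ∃ C : ℝ, 0 ≤ C ∧ ∀ s : ℝ, ∏ i, |s - p i| ^ (-(1 / 2) : ℝ) ≤
      C * ∑ i, |s - p i| ^ (-(1 / 2) : ℝ) := by
  classical
  -- With knots at least `2δ` apart, every knot other than the one nearest to `s` is at distance at
  -- least `δ` from `s`.
  obtain ⟨δ, hδ, hsep⟩ : ∃ δ : ℝ, 0 < δ ∧ ∀ i j, i ≠ j → 2 * δ ≤ |p i - p j| := by
    have : ∀ x : ι × ι, ∃ d : ℝ, 0 < d ∧ (x.1 ≠ x.2 → 2 * d ≤ |p x.1 - p x.2|) := by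
      intro x
      by_cases h : x.1 = x.2
      · exact ⟨1, one_pos, fun h' => absurd h h'⟩
      · have := abs_pos.2 (sub_ne_zero.2 (hp.ne h))
        exact ⟨|p x.1 - p x.2| / 2, by positivity, fun _ => by linarith⟩
    choose d hd hd' using this
    obtain ⟨x₀, -, hx₀⟩ := Finset.exists_min_image Finset.univ d Finset.univ_nonempty
    exact ⟨d x₀, hd x₀, fun i j hij => by
      linarith [hx₀ (i, j) (Finset.mem_univ _), hd' (i, j) hij]⟩
  set e : ℝ := δ ^ (-(1 / 2) : ℝ) with he
  have hnn : ∀ s (i : ι), 0 ≤ |s - p i| ^ (-(1 / 2) : ℝ) := fun s i =>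
    Real.rpow_nonneg (abs_nonneg _) _
  refine ⟨e ^ (Fintype.card ι - 1), pow_nonneg (Real.rpow_nonneg hδ.le _) _, fun s => ?_⟩
  obtain ⟨i₀, -, hi₀⟩ :=
    Finset.exists_min_image Finset.univ (fun i => |s - p i|) Finset.univ_nonempty
  rw [← Finset.mul_prod_erase _ _ (Finset.mem_univ i₀), mul_comm]
  have h1 : ∏ i ∈ Finset.univ.erase i₀, |s - p i| ^ (-(1 / 2) : ℝ) ≤ e ^ (Fintype.card ι - 1) := by
    rw [← Finset.card_univ, ← Finset.card_erase_of_mem (Finset.mem_univ i₀)]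
    rw [← Finset.prod_const]
    refine Finset.prod_le_prod (fun i _ => hnn s i) fun i hi => ?_
    refine Real.rpow_le_rpow_of_nonpos hδ ?_ (by norm_num)
    have h1 := hsep i i₀ (Finset.ne_of_mem_erase hi)
    have h2 := hi₀ i (Finset.mem_univ _)
    have h3 := abs_sub_le (p i) s (p i₀)
    rw [abs_sub_comm (p i) s] at h3
    linarith
  have h2 : |s - p i₀| ^ (-(1 / 2) : ℝ) ≤ ∑ i, |s - p i| ^ (-(1 / 2) : ℝ) :=
    Finset.single_le_sum (f := fun i => |s - p i| ^ (-(1 / 2) : ℝ)) (fun i _ => hnn s i)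
      (Finset.mem_univ i₀)
  exact mul_le_mul h1 h2 (hnn _ _) (pow_nonneg (Real.rpow_nonneg hδ.le _) _)

lemma locallyIntegrable_prod_abs_sub_rpow {p : ι → ℝ} (hp : Function.Injective p) :
    LocallyIntegrable fun s : ℝ => ∏ i, |s - p i| ^ (-(1 / 2) : ℝ) := by
  rcases isEmpty_or_nonempty ι with h | h
  · simpa using locallyIntegrable_const (1 : ℝ)
  obtain ⟨C, hC, hle⟩ := exists_prod_abs_sub_rpow_le_sum hp
  have hsum : LocallyIntegrable fun s : ℝ => C * ∑ i, |s - p i| ^ (-(1 / 2) : ℝ) :=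
    (locallyIntegrable_finsetSum _ fun i _ => locallyIntegrable_abs_sub_rpow (p i)).smul C
  refine hsum.mono ?_ ?_
  · exact Measurable.aestronglyMeasurable (by fun_prop)
  · refine Eventually.of_forall fun s => ?_
    rw [Real.norm_of_nonneg (Finset.prod_nonneg fun i _ => Real.rpow_nonneg (abs_nonneg _) _)]
    exact (hle s).trans (le_abs_self _)

end InvSqrt

/-! ### Cauchy's formula for the branch kernel. -/

section CauchyKernel

variable {ι : Type*} [Fintype ι]

/-- The branch on the closed upper half-plane of `(w - α)^q ∏ (w - pᵢ)^(-1/2)`. -/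
noncomputable def branchKernel (p : ι → ℝ) (α q : ℝ) (w : ℂ) : ℂ :=
  (w - α) ^ (q : ℂ) * ∏ i, (w - p i) ^ ((-(1 / 2) : ℝ) : ℂ)

variable (p : ι → ℝ) (α q : ℝ)

lemma norm_branchKernel (w : ℂ) :
    ‖branchKernel p α q w‖ = ‖w - α‖ ^ q * ∏ i, ‖w - p i‖ ^ (-(1 / 2) : ℝ) := by
  simp only [branchKernel, norm_mul, norm_prod, Complex.norm_cpow_real]

lemma differentiableAt_branchKernel {w : ℂ} (hα : w - α ∈ Complex.slitPlane)
    (hp : ∀ i, w - p i ∈ Complex.slitPlane) : DifferentiableAt ℂ (branchKernel p α q) w := by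
  have h : ∀ (c e : ℝ), w - c ∈ Complex.slitPlane →
      DifferentiableAt ℂ (fun w : ℂ => (w - c) ^ (e : ℂ)) w := fun c e hc =>
    (differentiableAt_id.sub_const _).cpow_const hc
  unfold branchKernel
  exact (h α q hα).mul (DifferentiableAt.fun_finsetProd fun i _ => h (p i) _ (hp i))

/-- The principal logarithm is continuous from above at the negative axis, so boundary values from
the upper half-plane are the principal powers themselves. -/
lemma tendsto_cpow_sub_nhdsGT {s c : ℝ} (hsc : s ≠ c) (e : ℂ) :
    Tendsto (fun ε : ℝ => ((s : ℂ) + ε * Complex.I - c) ^ e) (𝓝[>] 0) (𝓝 (((s : ℂ) - c) ^ e)) := by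
  have hne : (s : ℂ) - c ≠ 0 := by rw [sub_ne_zero]; exact_mod_cast hsc
  have hpath : Tendsto (fun ε : ℝ => (s : ℂ) + ε * Complex.I - c) (𝓝[>] 0) (𝓝 ((s : ℂ) - c)) := by
    have : Continuous fun ε : ℝ => (s : ℂ) + ε * Complex.I - c := by fun_prop
    have h := (this.tendsto 0).mono_left (nhdsWithin_le_nhds (s := Ioi 0))
    simpa using h
  have hlog : Tendsto (fun ε : ℝ => Complex.log ((s : ℂ) + ε * Complex.I - c)) (𝓝[>] 0)
      (𝓝 (Complex.log ((s : ℂ) - c))) := by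
    rcases lt_or_gt_of_ne hsc with h | h
    · have hre : ((s : ℂ) - c).re < 0 := by simpa using h
      have him : ((s : ℂ) - c).im = 0 := by simp
      refine (Complex.continuousWithinAt_log_of_re_neg_of_im_zero hre him).tendsto.comp
        (tendsto_nhdsWithin_iff.2 ⟨hpath, ?_⟩)
      filter_upwards [self_mem_nhdsWithin] with ε hε
      have : (0 : ℝ) < ε := hε
      simpa using this.le
    · refine (continuousAt_clog (Or.inl ?_)).tendsto.comp hpath
      simpa using h
  have hexp := (Complex.continuous_exp.tendsto _).comp (hlog.mul_const e)
  rw [Complex.cpow_def_of_ne_zero hne]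
  refine hexp.congr' ?_
  filter_upwards [self_mem_nhdsWithin] with ε hε
  have hε : (0 : ℝ) < ε := hε
  rw [Function.comp, Complex.cpow_def_of_ne_zero]
  intro h0
  have := congrArg Complex.im h0
  simp at this
  exact hε.ne' this

lemma tendsto_branchKernel {s : ℝ} (hα : s ≠ α) (hp : ∀ i, s ≠ p i) :
    Tendsto (fun ε : ℝ => branchKernel p α q (s + ε * Complex.I)) (𝓝[>] 0)
      (𝓝 (branchKernel p α q s)) := by
  unfold branchKernel
  exact (tendsto_cpow_sub_nhdsGT hα _).mul
    (tendsto_finsetProd _ fun i _ => tendsto_cpow_sub_nhdsGT (hp i) _)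

lemma branchKernel_ofReal {z : ℝ} (hα : α ≤ z) (hp : ∀ i, p i ≤ z) :
    branchKernel p α q z = (((z - α) ^ q * ∏ i, (z - p i) ^ (-(1 / 2) : ℝ) : ℝ) : ℂ) := by
  unfold branchKernel
  rw [Complex.ofReal_mul, Complex.ofReal_prod, Complex.ofReal_cpow (by linarith)]
  congr 1
  · simp
  · refine Finset.prod_congr rfl fun i _ => ?_
    rw [Complex.ofReal_cpow (by linarith [hp i])]
    simp

/-- The exponents add up to `q - card/2 = -1`. The radius is large enough for `|w - α| ≤ 2|w|` and
`|w - p i| ≥ |w|/2`. -/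
lemma exists_norm_branchKernel_le (hq : 0 ≤ q) (hcard : q + 1 = Fintype.card ι / 2) :
    ∃ C R : ℝ, 0 ≤ C ∧ 0 < R ∧ ∀ w : ℂ, R ≤ ‖w‖ → ‖branchKernel p α q w‖ ≤ C / ‖w‖ := by
  set R : ℝ := 2 * (|α| + ∑ i, |p i| + 1) with hR
  have hsum : 0 ≤ ∑ i, |p i| := Finset.sum_nonneg fun i _ => abs_nonneg _
  refine ⟨2 ^ q * (2⁻¹ : ℝ) ^ (-(1 / 2) * (Fintype.card ι : ℝ)), R, by positivity, by positivity,
    fun w hw => ?_⟩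
  have hw0 : 0 < ‖w‖ := lt_of_lt_of_le (by positivity) hw
  rw [norm_branchKernel]
  have h1 : ‖w - α‖ ≤ 2 * ‖w‖ := by
    refine (norm_sub_le _ _).trans ?_
    rw [Complex.norm_real, Real.norm_eq_abs]
    linarith
  have h2 : ∀ i, 2⁻¹ * ‖w‖ ≤ ‖w - p i‖ := by
    intro i
    have h := norm_sub_norm_le w (p i)
    rw [Complex.norm_real, Real.norm_eq_abs] at h
    have := Finset.single_le_sum (f := fun i => |p i|) (fun i _ => abs_nonneg _) (Finset.mem_univ i)
    have h0 := abs_nonneg α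
    linarith
  have h3 : ∏ i, ‖w - p i‖ ^ (-(1 / 2) : ℝ) ≤ (2⁻¹ * ‖w‖) ^ (-(1 / 2) * (Fintype.card ι : ℝ)) := by
    rw [Real.rpow_mul (by positivity), Real.rpow_natCast, ← Finset.card_univ, ← Finset.prod_const]
    exact Finset.prod_le_prod (fun i _ => Real.rpow_nonneg (norm_nonneg _) _) fun i _ =>
      Real.rpow_le_rpow_of_nonpos (by positivity) (h2 i) (by norm_num)
  calc ‖w - α‖ ^ q * ∏ i, ‖w - p i‖ ^ (-(1 / 2) : ℝ)
      ≤ (2 * ‖w‖) ^ q * (2⁻¹ * ‖w‖) ^ (-(1 / 2) * (Fintype.card ι : ℝ)) := by gcongr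
    _ = 2 ^ q * (2⁻¹ : ℝ) ^ (-(1 / 2) * (Fintype.card ι : ℝ)) *
        (‖w‖ ^ q * ‖w‖ ^ (-(1 / 2) * (Fintype.card ι : ℝ))) := by
      rw [Real.mul_rpow (by norm_num) hw0.le, Real.mul_rpow (by norm_num) hw0.le]; ring
    _ = _ := by
      rw [← Real.rpow_add hw0, show q + -(1 / 2) * (Fintype.card ι : ℝ) = -1 by linarith,
        Real.rpow_neg_one, ← div_eq_mul_inv]

/-- The kernel of the contour argument: `branchKernel` with its value at `z` subtracted, divided by
`w - z`. -/
noncomputable def contourKernel (z : ℝ) (w : ℂ) : ℂ :=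
  (branchKernel p α q w - branchKernel p α q z * ((z + Complex.I) / (w + Complex.I))) / (w - z)

variable {p α q}

lemma sub_ofReal_mem_slitPlane {w : ℂ} (hw : 0 < w.im) (c : ℝ) : w - c ∈ Complex.slitPlane :=
  Or.inr (by simpa using hw.ne')

lemma add_I_ne_zero {w : ℂ} (hw : 0 ≤ w.im) : w + Complex.I ≠ 0 := by
  intro h
  have := congrArg Complex.im h
  simp at this
  linarith

lemma differentiableOn_contourKernel (z : ℝ) :
    DifferentiableOn ℂ (contourKernel p α q z) {w | 0 < w.im} := by
  intro w hw
  have hw : 0 < w.im := hw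
  have h1 := differentiableAt_branchKernel p α q (sub_ofReal_mem_slitPlane hw α)
    fun i => sub_ofReal_mem_slitPlane hw (p i)
  refine DifferentiableAt.differentiableWithinAt ?_
  unfold contourKernel
  refine (h1.sub ((differentiableAt_const _).mul ((differentiableAt_const _).div
    (differentiableAt_id.add_const _) (add_I_ne_zero hw.le)))).div
    (differentiableAt_id.sub_const _) ?_
  exact Complex.slitPlane_ne_zero (sub_ofReal_mem_slitPlane hw z)

lemma tendsto_contourKernel {s z : ℝ} (hα : s ≠ α) (hp : ∀ i, s ≠ p i) (hz : s ≠ z) :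
    Tendsto (fun ε : ℝ => contourKernel p α q z (s + ε * Complex.I)) (𝓝[>] 0)
      (𝓝 (contourKernel p α q z s)) := by
  have hpath : ∀ c : ℂ, Tendsto (fun ε : ℝ => (s : ℂ) + ε * Complex.I + c) (𝓝[>] 0)
      (𝓝 ((s : ℂ) + c)) := by
    intro c
    have : Continuous fun ε : ℝ => (s : ℂ) + ε * Complex.I + c := by fun_prop
    have h := (this.tendsto 0).mono_left (nhdsWithin_le_nhds (s := Ioi 0))
    simpa using h
  unfold contourKernel
  refine ((tendsto_branchKernel p α q hα hp).sub (tendsto_const_nhds.mul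
    (tendsto_const_nhds.div (hpath Complex.I) (add_I_ne_zero (by simp))))).div ?_ ?_
  · simpa [sub_eq_add_neg] using hpath (-z)
  · rw [sub_ne_zero]; exact_mod_cast hz

/-- The factor `(z + i)/(w + i)` is `1` at `w = z`, so the numerator vanishes there. It is
differentiable at `z`, which lies right of every branch point, so the difference quotient is
bounded. -/
lemma exists_norm_contourKernel_le_near {z : ℝ} (hα : α < z) (hp : ∀ i, p i < z) :
    ∃ C r : ℝ, 0 ≤ C ∧ 0 < r ∧ ∀ w : ℂ, ‖w - z‖ < r → ‖contourKernel p α q z w‖ ≤ C := by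
  have hslit : ∀ c : ℝ, c < z → (z : ℂ) - c ∈ Complex.slitPlane := fun c hc =>
    Or.inl (by simpa using hc)
  have hI := add_I_ne_zero (w := (z : ℂ)) (by simp)
  have hd : DifferentiableAt ℂ (fun w => branchKernel p α q w -
      branchKernel p α q z * ((z + Complex.I) / (w + Complex.I))) z :=
    (differentiableAt_branchKernel p α q (hslit α hα) fun i => hslit _ (hp i)).sub
      ((differentiableAt_const _).mul ((differentiableAt_const _).div
        (differentiableAt_id.add_const _) hI))
  obtain ⟨C, hC, hbig⟩ := hd.isBigO_sub.exists_pos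
  obtain ⟨r, hr, hball⟩ := Metric.eventually_nhds_iff.1 hbig.bound
  refine ⟨C, r, hC.le, hr, fun w hw => ?_⟩
  have h := hball (show dist w z < r by rwa [dist_eq_norm])
  rw [div_self hI, mul_one, sub_self, sub_zero] at h
  unfold contourKernel
  rw [norm_div]
  exact div_le_of_le_mul₀ (norm_nonneg _) hC.le h

/-- The factor `(z + i)/(w + i)` makes the subtracted constant decay like `1/|w|`, as `branchKernel`
does, without a pole in the upper half-plane; dividing by `w - z` gives the second power. -/
lemma exists_norm_contourKernel_le_far (z : ℝ) (hq : 0 ≤ q) (hcard : q + 1 = Fintype.card ι / 2) :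
    ∃ C R : ℝ, 0 ≤ C ∧ 1 ≤ R ∧
      ∀ w : ℂ, 0 < w.im → R ≤ ‖w‖ → ‖contourKernel p α q z w‖ ≤ C / ‖w‖ ^ 2 := by
  obtain ⟨C, R, hC, hR, hle⟩ := exists_norm_branchKernel_le p α q hq hcard
  set D : ℝ := ‖branchKernel p α q z * (z + Complex.I)‖ with hD
  refine ⟨2 * (C + D), max R (2 * |z| + 1), by positivity,
    le_max_of_le_right (by linarith [abs_nonneg z]), fun w hw hwR => ?_⟩
  have hw1 : 0 < ‖w‖ := hR.trans_le ((le_max_left _ _).trans hwR)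
  have h1 := hle w ((le_max_left _ _).trans hwR)
  have h2 : ‖w‖ ≤ ‖w + Complex.I‖ := by
    rw [Complex.norm_def, Complex.norm_def]
    refine Real.sqrt_le_sqrt ?_
    simp only [Complex.normSq_apply, Complex.add_re, Complex.I_re, Complex.add_im, Complex.I_im]
    nlinarith
  have h3 : ‖w‖ / 2 ≤ ‖w - z‖ := by
    have h := norm_sub_norm_le w z
    rw [Complex.norm_real, Real.norm_eq_abs] at h
    have := (le_max_right _ _).trans hwR
    linarith
  unfold contourKernel
  rw [norm_div, div_le_iff₀ ((half_pos hw1).trans_le h3)]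
  calc _ ≤ ‖branchKernel p α q w‖ +
        ‖branchKernel p α q z * ((z + Complex.I) / (w + Complex.I))‖ := norm_sub_le _ _
    _ ≤ C / ‖w‖ + D / ‖w‖ := by
      rw [← mul_div_assoc, norm_div]
      gcongr
    _ = 2 * (C + D) / ‖w‖ ^ 2 * (‖w‖ / 2) := by field_simp
    _ ≤ _ := by gcongr

/-- The domination needed to pass to the boundary. -/
lemma exists_integrable_bound_contourKernel {z : ℝ} (hinj : Function.Injective p) (hα : α < z)
    (hp : ∀ i, p i < z) (hq : 0 ≤ q) (hcard : q + 1 = Fintype.card ι / 2) :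
    ∃ bound : ℝ → ℝ, Integrable bound ∧ ∀ ε : ℝ, 0 < ε → ε ≤ 1 →
      ∀ᵐ s : ℝ, ‖contourKernel p α q z (s + ε * Complex.I)‖ ≤ bound s := by
  obtain ⟨C₁, r, hC₁, hr, hnear⟩ := exists_norm_contourKernel_le_near (q := q) hα hp
  obtain ⟨C, R, hC, hR, hfar⟩ := exists_norm_contourKernel_le_far (p := p) (α := α) z hq hcard
  set D : ℝ := R + 1 + |α| with hD
  set E : ℝ := ‖branchKernel p α q z * (z + Complex.I)‖ with hE
  set P : ℝ → ℝ := fun s => ∏ i, |s - p i| ^ (-(1 / 2) : ℝ) with hP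
  have hPnn : ∀ s, 0 ≤ P s := fun s =>
    Finset.prod_nonneg fun i _ => Real.rpow_nonneg (abs_nonneg _) _
  -- The first term handles `|s| > R ≥ 1`, where `1/s² ≤ 2/(1 + s²)`. On `[-R, R]`, `C₁` covers the
  -- disc of radius `r` about `z`; off it the denominator is at least `r`, and `|w - p i| ≥ |s - p
  -- i|` bounds the product by `P s`.
  refine ⟨fun s => 2 * C * (1 + s ^ 2)⁻¹ +
    (Icc (-R) R).indicator (fun s => C₁ + E / r + D ^ q / r * P s) s, ?_, ?_⟩
  · refine (integrable_inv_one_add_sq.const_mul _).add ?_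
    rw [integrable_indicator_iff measurableSet_Icc]
    refine IntegrableOn.add ?_ ?_
    · exact (continuous_const.integrableOn_Icc)
    · exact ((locallyIntegrable_prod_abs_sub_rpow hinj).integrableOn_isCompact
        isCompact_Icc).const_mul _
  · intro ε hε hε1
    -- At a knot `P` takes the default value `0 ^ (-1/2) = 0` and dominates nothing.
    have hne : ∀ᵐ s : ℝ, ∀ i, s ≠ p i := ae_all_iff.2 fun i => by
      simp [ae_iff, measure_singleton]
    filter_upwards [hne] with s hs
    set w : ℂ := s + ε * Complex.I with hw
    have him : w.im = ε := by simp [hw]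
    have hre : w.re = s := by simp [hw]
    have hterm : 0 ≤ 2 * C * (1 + s ^ 2)⁻¹ := by positivity
    by_cases hsR : s ∈ Icc (-R) R
    · rw [indicator_of_mem hsR]
      refine le_trans ?_ (le_add_of_nonneg_left hterm)
      have hrest : 0 ≤ E / r + D ^ q / r * P s := by
        have := hPnn s
        positivity
      by_cases hwz : ‖w - z‖ < r
      · linarith [hnear w hwz]
      push Not at hwz
      have h1 : ‖branchKernel p α q w‖ ≤ D ^ q * P s := by
        rw [norm_branchKernel]
        have ha : ‖w - α‖ ≤ D := by
          have hs' := abs_le.2 hsR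
          calc ‖w - α‖ ≤ ‖w‖ + ‖(α : ℂ)‖ := norm_sub_le _ _
            _ ≤ ‖(s : ℂ)‖ + ‖(ε : ℂ) * Complex.I‖ + ‖(α : ℂ)‖ := by
              gcongr; exact norm_add_le _ _
            _ = |s| + ε + |α| := by
              rw [norm_mul, Complex.norm_I, mul_one, Complex.norm_real, Complex.norm_real,
                Complex.norm_real, Real.norm_eq_abs, Real.norm_eq_abs, Real.norm_eq_abs,
                abs_of_pos hε]
            _ ≤ D := by rw [hD]; gcongr
        refine mul_le_mul (Real.rpow_le_rpow (norm_nonneg _) ha hq) ?_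
          (Finset.prod_nonneg fun i _ => Real.rpow_nonneg (norm_nonneg _) _) (by positivity)
        refine Finset.prod_le_prod (fun i _ => Real.rpow_nonneg (norm_nonneg _) _) fun i _ => ?_
        refine Real.rpow_le_rpow_of_nonpos (abs_pos.2 (sub_ne_zero.2 (hs i))) ?_ (by norm_num)
        have := Complex.abs_re_le_norm (w - p i)
        simpa [hre] using this
      have h2 : 1 ≤ ‖w + Complex.I‖ := by
        have := Complex.abs_im_le_norm (w + Complex.I)
        rw [Complex.add_im, Complex.I_im, him, abs_of_pos (by linarith)] at this
        linarith
      have h3 : ‖contourKernel p α q z w‖ ≤ (D ^ q * P s + E) / r := by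
        unfold contourKernel
        rw [norm_div]
        gcongr
        refine (norm_sub_le _ _).trans (add_le_add h1 ?_)
        rw [← mul_div_assoc, norm_div]
        exact div_le_self (norm_nonneg _) h2
      have : (D ^ q * P s + E) / r = E / r + D ^ q / r * P s := by ring
      linarith
    · rw [indicator_of_notMem hsR, add_zero]
      have hs' : R < |s| := by
        rw [← not_le, abs_le]; exact hsR
      have hsw : |s| ≤ ‖w‖ := by simpa [hre] using Complex.abs_re_le_norm w
      refine (hfar w (by rwa [him]) (hs'.le.trans hsw)).trans ?_
      have hs1 : 1 ≤ s ^ 2 := by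
        rw [← sq_abs]; nlinarith
      have hw0 : 0 < ‖w‖ := by linarith
      have hs2 : s ^ 2 ≤ ‖w‖ ^ 2 := by
        rw [← sq_abs]; gcongr
      rw [← div_eq_mul_inv, div_le_div_iff₀ (by positivity) (by positivity)]
      nlinarith

/-- **Cauchy's formula for the branch kernel**: to the right of all knots, `branchKernel` is the
Cauchy transform of its imaginary part on the real line. -/
theorem integral_im_branchKernel_div {z : ℝ} (hinj : Function.Injective p) (hα : α < z)
    (hp : ∀ i, p i < z) (hq : 0 ≤ q) (hcard : q + 1 = Fintype.card ι / 2) :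
    ∫ s : ℝ, (branchKernel p α q s).im / (s - z) =
      Real.pi * ((z - α) ^ q * ∏ i, (z - p i) ^ (-(1 / 2) : ℝ)) := by
  obtain ⟨bound, hbound, hle⟩ := exists_integrable_bound_contourKernel hinj hα hp hq hcard
  obtain ⟨C, R, -, -, hfar⟩ := exists_norm_contourKernel_le_far (p := p) (α := α) z hq hcard
  have hne : ∀ c : ℝ, ∀ᵐ s : ℝ, s ≠ c := fun c => by simp [ae_iff, measure_singleton]
  obtain ⟨hint, hzero⟩ := integral_boundary_eq_zero (differentiableOn_contourKernel z) hfar hbound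
    hle (by
      filter_upwards [hne α, hne z, ae_all_iff.2 fun i => hne (p i)] with s h1 h2 h3
      exact tendsto_contourKernel h1 h3 h2)
  set h : ℝ := (z - α) ^ q * ∏ i, (z - p i) ^ (-(1 / 2) : ℝ) with hh
  have hval : branchKernel p α q z = (h : ℂ) := branchKernel_ofReal p α q hα.le fun i => (hp i).le
  have hIm : ∫ s : ℝ, (contourKernel p α q z s).im = 0 := by
    have := integral_im hint
    simp only [RCLike.im_to_complex] at this
    rw [this, hzero, Complex.zero_im]
  -- The subtracted term splits as `(z + i)/((s + i)(s - z)) = 1/(s - z) - 1/(s + i)`. Its imaginary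
  -- part on the real line is `1/(1 + s²)`, whose integral is the `π` of the formula.
  have hpt : (fun s : ℝ => (branchKernel p α q s).im / (s - z)) =ᵐ[volume]
      fun s => (contourKernel p α q z s).im + h * (1 + s ^ 2)⁻¹ := by
    filter_upwards [hne z] with s hs
    have hsz : (s : ℂ) - z ≠ 0 := by rw [sub_ne_zero]; exact_mod_cast hs
    have hsI := add_I_ne_zero (w := (s : ℂ)) (by simp)
    have hs2 : (1 + (s : ℂ) ^ 2) ≠ 0 := by
      have : (1 + s ^ 2 : ℝ) ≠ 0 := by positivity
      exact_mod_cast this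
    have hdec : branchKernel p α q s / (s - z) = contourKernel p α q z s +
        h * (1 / (s - z) - (s - Complex.I) / (1 + s ^ 2)) := by
      unfold contourKernel
      rw [hval]
      have hfac : (1 + (s : ℂ) ^ 2) = (s + Complex.I) * (s - Complex.I) := by
        ring_nf; rw [Complex.I_sq]; ring
      have hsI' : (s : ℂ) - Complex.I ≠ 0 := fun h0 => hs2 (by rw [hfac, h0, mul_zero])
      rw [hfac]
      field_simp
      ring
    have h1 := congrArg Complex.im hdec
    have e1 : ((1 : ℂ) / (s - z)) = ((1 / (s - z) : ℝ) : ℂ) := by push_cast; rfl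
    have e2 : (((s : ℂ) - Complex.I) / (1 + s ^ 2)) =
        ((s / (1 + s ^ 2) : ℝ) : ℂ) - (((1 + s ^ 2)⁻¹ : ℝ) : ℂ) * Complex.I := by
      push_cast; field_simp
    have e3 : ((s : ℂ) - z) = ((s - z : ℝ) : ℂ) := by push_cast; rfl
    rw [e1, e2, e3, Complex.div_ofReal_im] at h1
    rw [h1, Complex.add_im, Complex.im_ofReal_mul, Complex.sub_im, Complex.sub_im,
      Complex.im_ofReal_mul, Complex.ofReal_im, Complex.ofReal_im, Complex.I_im]
    ring
  have hintIm : Integrable fun s : ℝ => (contourKernel p α q z s).im := hint.im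
  rw [integral_congr_ae hpt, integral_add hintIm (integrable_inv_one_add_sq.const_mul _),
    hIm, integral_const_mul, integral_univ_inv_one_add_sq, zero_add, mul_comm]

end CauchyKernel

/-! ### Gaussian integrals and means over the sphere. -/

section Transforms

lemma lintegral_ofReal_fintype_prod {ι : Type*} [Fintype ι] {f : ι → ℝ → ℝ}
    (hf : ∀ i, Integrable (f i)) (hnn : ∀ i x, 0 ≤ f i x) :
    ∫⁻ x : ι → ℝ, ENNReal.ofReal (∏ i, f i (x i)) = ENNReal.ofReal (∏ i, ∫ x, f i x) := by
  rw [← integral_fintype_prod_eq_prod (μ := fun _ => volume) f, ← volume_pi,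
    ofReal_integral_eq_lintegral_ofReal]
  · exact Integrable.fintype_prod (f := f) (μ := fun _ => volume) hf
  · exact Eventually.of_forall fun x => Finset.prod_nonneg fun i _ => hnn i _

/-- Polar coordinates in `lintegral` form. -/
lemma lintegral_eq_lintegral_toSphere {N : ℕ} (hN : N ≠ 0)
    {f : EuclideanSpace ℝ (Fin N) → ENNReal} (hf : Measurable f) :
    ∫⁻ x, f x = ∫⁻ u, (∫⁻ r in Ioi (0 : ℝ), ENNReal.ofReal (r ^ (N - 1)) *
        f (r • (u : EuclideanSpace ℝ (Fin N))))
          ∂(volume : Measure (EuclideanSpace ℝ (Fin N))).toSphere := by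
  have : Nonempty (Fin N) := ⟨⟨0, Nat.pos_of_ne_zero hN⟩⟩
  set μ : Measure (EuclideanSpace ℝ (Fin N)) := volume with hμ
  have hcompl : ∫⁻ x, f x ∂μ =
      ∫⁻ x : ({0}ᶜ : Set (EuclideanSpace ℝ (Fin N))), f x ∂(μ.comap (↑)) := by
    rw [lintegral_subtype_comap (measurableSet_singleton _).compl, restrict_compl_singleton]
  have hmp := μ.measurePreserving_homeomorphUnitSphereProd
  have hg : Measurable fun y : Metric.sphere (0 : EuclideanSpace ℝ (Fin N)) 1 × Ioi (0 : ℝ) =>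
      f ((y.2 : ℝ) • (y.1 : EuclideanSpace ℝ (Fin N))) := hf.comp (by fun_prop)
  have h1 := hmp.lintegral_comp hg
  have h2 : ∀ x : ({0}ᶜ : Set (EuclideanSpace ℝ (Fin N))),
      (((homeomorphUnitSphereProd _ x).2 : ℝ) •
        ((homeomorphUnitSphereProd _ x).1 : EuclideanSpace ℝ (Fin N))) = x := by
    intro x
    simp [smul_smul, mul_inv_cancel₀ (norm_ne_zero_iff.2 x.2)]
  simp_rw [h2] at h1
  rw [hcompl, h1, lintegral_prod _ hg.aemeasurable]
  refine lintegral_congr fun u => ?_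
  rw [Measure.volumeIoiPow]
  refine (lintegral_withDensity_eq_lintegral_mul _ (by fun_prop)
    (hg.comp (measurable_const.prodMk measurable_id) : Measurable fun r : Ioi (0 : ℝ) =>
      f ((r : ℝ) • (u : EuclideanSpace ℝ (Fin N))))).trans ?_
  simp only [Pi.mul_apply, finrank_euclideanSpace, Fintype.card_fin]
  exact lintegral_subtype_comap measurableSet_Ioi
    (fun r : ℝ => ENNReal.ofReal (r ^ (N - 1)) * f (r • (u : EuclideanSpace ℝ (Fin N))))

/-- The radial part of the Gaussian integral; it is the source of the exponent `N/2` of the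
transforms. -/
lemma lintegral_pow_mul_exp_neg_mul_sq {N : ℕ} (hN : N ≠ 0) {B : ℝ} (hB : 0 < B) :
    ∫⁻ r in Ioi (0 : ℝ), ENNReal.ofReal (r ^ (N - 1)) * ENNReal.ofReal (Real.exp (-(B * r ^ 2))) =
      ENNReal.ofReal (Real.Gamma (N / 2) / 2) * ENNReal.ofReal (B ^ (-((N : ℝ) / 2))) := by
  have hN1 : (1 : ℝ) ≤ N := by exact_mod_cast Nat.one_le_iff_ne_zero.2 hN
  have hq : (-1 : ℝ) < (N - 1 : ℕ) := by
    have : (0 : ℝ) ≤ (N - 1 : ℕ) := Nat.cast_nonneg _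
    linarith
  have hI := integral_rpow_mul_exp_neg_mul_rpow (p := 2) (q := (N - 1 : ℕ)) two_pos hq hB
  have hcast : ((N - 1 : ℕ) : ℝ) + 1 = N := by
    rw [Nat.cast_sub (Nat.one_le_iff_ne_zero.2 hN)]; simp
  rw [hcast] at hI
  have hΓ : 0 < Real.Gamma (N / 2) := Real.Gamma_pos_of_pos (by linarith)
  have hpos : 0 < B ^ (-(N : ℝ) / 2) * (1 / 2) * Real.Gamma (N / 2) := by positivity
  -- A nonintegrable function has integral `0` by convention, so a nonzero value proves
  -- integrability.
  have hint := Integrable.of_integral_ne_zero (hI.trans_ne hpos.ne')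
  have h := ofReal_integral_eq_lintegral_ofReal hint (by
    filter_upwards [ae_restrict_mem measurableSet_Ioi] with r hr
    exact mul_nonneg (Real.rpow_nonneg (le_of_lt hr) _) (Real.exp_pos _).le)
  rw [hI] at h
  rw [← ENNReal.ofReal_mul (by positivity)]
  convert h.symm using 1
  · refine setLIntegral_congr_fun measurableSet_Ioi fun r hr => ?_
    have hr : 0 < r := hr
    simp only [Real.rpow_natCast]
    rw [← ENNReal.ofReal_mul (by positivity)]
    congr 3
    norm_num
  · congr 1
    rw [neg_div]; ring

/-- The Gaussian integral of a positive function homogeneous of degree two, in polar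
coordinates. -/
lemma lintegral_exp_neg_homogeneous {N : ℕ} (hN : N ≠ 0) {F : EuclideanSpace ℝ (Fin N) → ℝ}
    (hF : Measurable F) (hhom : ∀ (r : ℝ) x, F (r • x) = r ^ 2 * F x)
    (hpos : ∀ x ∈ Metric.sphere (0 : EuclideanSpace ℝ (Fin N)) 1, 0 < F x) :
    ∫⁻ x, ENNReal.ofReal (Real.exp (-F x)) = ENNReal.ofReal (Real.Gamma (N / 2) / 2) *
      ∫⁻ u, ENNReal.ofReal (F u ^ (-((N : ℝ) / 2)))
        ∂(volume : Measure (EuclideanSpace ℝ (Fin N))).toSphere := by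
  rw [lintegral_eq_lintegral_toSphere hN (by fun_prop), ← lintegral_const_mul _ (by fun_prop)]
  refine lintegral_congr fun u => ?_
  rw [← lintegral_pow_mul_exp_neg_mul_sq hN (hpos u u.2)]
  simp_rw [hhom, mul_comm]

lemma lintegral_exp_neg_sum_sq {N : ℕ} {b : Fin N → ℝ} (hb : ∀ i, 0 < b i) :
    ∫⁻ x : EuclideanSpace ℝ (Fin N), ENNReal.ofReal (Real.exp (-∑ i, b i * x i ^ 2)) =
      ENNReal.ofReal (Real.pi ^ ((N : ℝ) / 2)) *
        ENNReal.ofReal (∏ i, b i ^ (-(1 / 2) : ℝ)) := by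
  have h := (PiLp.volume_preserving_ofLp (Fin N)).lintegral_comp
    (f := fun x : Fin N → ℝ => ENNReal.ofReal (∏ i, Real.exp (-b i * x i ^ 2))) (by fun_prop)
  rw [lintegral_ofReal_fintype_prod (fun i => integrable_exp_neg_mul_sq (hb i))
    (fun i x => (Real.exp_pos _).le)] at h
  simp_rw [integral_gaussian, ← Real.exp_sum, neg_mul, Finset.sum_neg_distrib] at h
  rw [h, ← ENNReal.ofReal_mul (by positivity)]
  congr 1
  have h1 : ∀ i, √(Real.pi / b i) = Real.pi ^ (1 / 2 : ℝ) * b i ^ (-(1 / 2) : ℝ) := by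
    intro i
    rw [Real.sqrt_eq_rpow, div_eq_mul_inv, Real.mul_rpow Real.pi_pos.le (inv_pos.2 (hb i)).le,
      Real.inv_rpow (hb i).le, ← Real.rpow_neg (hb i).le]
  simp_rw [h1, Finset.prod_mul_distrib, Finset.prod_const, Finset.card_univ, Fintype.card_fin]
  rw [← Real.rpow_natCast, ← Real.rpow_mul Real.pi_pos.le]
  congr 2
  ring

lemma sum_sq_isometry_eq_one {N : ℕ}
    (e : EuclideanSpace ℝ (Fin N) ≃ₗᵢ[ℝ] EuclideanSpace ℝ (Fin N))
    (u : Metric.sphere (0 : EuclideanSpace ℝ (Fin N)) 1) : ∑ i, e u.1 i ^ 2 = 1 := by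
  have := EuclideanSpace.real_norm_sq_eq (e u.1)
  rw [e.norm_map, mem_sphere_zero_iff_norm.1 u.2] at this
  simpa using this.symm

/-- The mean of a power of a positive quadratic form over the uniform distribution on the
sphere. -/
lemma lintegral_sphereUniform_quadratic {N : ℕ} (hN : N ≠ 0) {b : Fin N → ℝ} (hb : ∀ i, 0 < b i)
    (e : EuclideanSpace ℝ (Fin N) ≃ₗᵢ[ℝ] EuclideanSpace ℝ (Fin N)) :
    ∫⁻ u, ENNReal.ofReal ((∑ i, b i * e u.1 i ^ 2) ^ (-((N : ℝ) / 2))) ∂(sphereUniform N) =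
      ENNReal.ofReal (∏ i, b i ^ (-(1 / 2) : ℝ)) := by
  -- One Gaussian integral computed in Cartesian coordinates (left) and in polar coordinates
  -- (right).
  have main : ∀ {b : Fin N → ℝ}, (∀ i, 0 < b i) →
      ENNReal.ofReal (Real.pi ^ ((N : ℝ) / 2)) * ENNReal.ofReal (∏ i, b i ^ (-(1 / 2) : ℝ)) =
      ENNReal.ofReal (Real.Gamma (N / 2) / 2) *
        ∫⁻ u, ENNReal.ofReal ((∑ i, b i * e u.1 i ^ 2) ^ (-((N : ℝ) / 2)))
          ∂(volume : Measure (EuclideanSpace ℝ (Fin N))).toSphere := by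
    intro b hb
    rw [← lintegral_exp_neg_sum_sq hb, ← e.measurePreserving.lintegral_comp (by fun_prop)]
    refine lintegral_exp_neg_homogeneous hN (F := fun x => ∑ i, b i * e x i ^ 2) (by fun_prop)
      (fun r x => ?_) fun x hx => ?_
    · simp only [map_smul, PiLp.smul_apply, smul_eq_mul, Finset.mul_sum]
      exact Finset.sum_congr rfl fun i _ => by ring
    · have hne : e x ≠ 0 := by
        intro h
        have := e.norm_map x
        rw [h, norm_zero, mem_sphere_zero_iff_norm.1 hx] at this
        norm_num at this
      obtain ⟨i, hi⟩ : ∃ i, e x i ≠ 0 := by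
        by_contra hcon
        push Not at hcon
        exact hne (by ext i; exact hcon i)
      exact Finset.sum_pos' (fun j _ => mul_nonneg (hb j).le (sq_nonneg _))
        ⟨i, Finset.mem_univ i, mul_pos (hb i) (by positivity)⟩
  -- With `b = 1` the integrand on the sphere is `1`, which gives the total surface mass and so
  -- removes both constants.
  have h1 := main (b := fun _ => 1) fun _ => one_pos
  have hone := sum_sq_isometry_eq_one e
  simp only [one_mul, hone, Real.one_rpow, Finset.prod_const_one, ENNReal.ofReal_one, mul_one,
    lintegral_const] at h1
  have h2 := main hb
  rw [h1] at h2
  have hN1 : (1 : ℝ) ≤ N := by exact_mod_cast Nat.one_le_iff_ne_zero.2 hN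
  have hΓ : 0 < Real.Gamma (N / 2) := Real.Gamma_pos_of_pos (by linarith)
  rw [mul_assoc, ENNReal.mul_right_inj (by simpa using hΓ) ENNReal.ofReal_ne_top] at h2
  rw [sphereUniform, lintegral_smul_measure, ← h2, smul_eq_mul, ← mul_assoc,
    ENNReal.inv_mul_cancel, one_mul]
  · intro h0
    rw [h0, mul_zero] at h1
    have := ENNReal.ofReal_eq_zero.1 h1
    have hpi : 0 < Real.pi ^ ((N : ℝ) / 2) := by positivity
    linarith
  · exact measure_ne_top _ _

end Transforms

/-! ### The transform of the real shadow. -/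

section Shadow

/-- A real symmetric matrix with simple spectrum `{a₁, …, a_N}` is diagonalized by a linear
isometry. -/
lemma exists_isometry_quadraticForm {N : ℕ} {a : Fin N → ℝ} (ha : Function.Injective a)
    {A : Matrix (Fin N) (Fin N) ℝ} (hA : A.IsSymm) (hspec : spectrum ℝ A = range a) :
    ∃ e : EuclideanSpace ℝ (Fin N) ≃ₗᵢ[ℝ] EuclideanSpace ℝ (Fin N),
      ∀ x : EuclideanSpace ℝ (Fin N),
        dotProduct (WithLp.ofLp x) (A.mulVec (WithLp.ofLp x)) = ∑ i, a i * e x i ^ 2 := by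
  have hH : A.IsHermitian := by
    rw [Matrix.IsHermitian, Matrix.conjTranspose_eq_transpose_of_trivial]; exact hA
  have hrange : range a = range hH.eigenvalues := by
    rw [← hspec, hH.spectrum_real_eq_range_eigenvalues]
  have hmem : ∀ i, ∃ j, hH.eigenvalues j = a i := fun i => by
    have : a i ∈ range hH.eigenvalues := hrange ▸ mem_range_self i
    exact this
  -- As the `N` values `a i` are distinct, `σ` is a bijection, and the eigenbasis can be renumbered
  -- so that its `i`-th vector belongs to `a i`.
  choose σ hσ using hmem
  have hσinj : Function.Injective σ := fun i j hij => ha (by rw [← hσ i, ← hσ j, hij])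
  set τ : Fin N ≃ Fin N := Equiv.ofBijective σ (Finite.injective_iff_bijective.1 hσinj) with hτ
  set b := hH.eigenvectorBasis.reindex τ.symm with hb
  refine ⟨b.repr, fun x => ?_⟩
  set y : EuclideanSpace ℝ (Fin N) := WithLp.toLp 2 (A.mulVec (WithLp.ofLp x)) with hy
  have hinner : ∀ u v : EuclideanSpace ℝ (Fin N),
      inner ℝ u v = dotProduct (WithLp.ofLp u) (WithLp.ofLp v) := fun u v => by
    rw [EuclideanSpace.inner_eq_star_dotProduct, star_trivial, dotProduct_comm]
  have hcoord : ∀ i, inner ℝ (b i) y = a i * inner ℝ (b i) x := by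
    intro i
    have hbi : b i = hH.eigenvectorBasis (σ i) := by simp [hb, hτ]
    have hev := hH.mulVec_eigenvectorBasis (σ i)
    rw [hσ i] at hev
    rw [hinner, hinner, hbi, hy, Matrix.dotProduct_mulVec, ← Matrix.mulVec_transpose, hA.eq]
    erw [hev]
    rw [smul_dotProduct, smul_eq_mul]
  have h1 : dotProduct (WithLp.ofLp x) (A.mulVec (WithLp.ofLp x)) = inner ℝ x y := by
    rw [hinner]
  rw [h1, ← b.sum_inner_mul_inner x y]
  refine Finset.sum_congr rfl fun i _ => ?_
  rw [hcoord, b.repr_apply_apply, real_inner_comm]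
  ring

variable {N : ℕ} {a : Fin N → ℝ} {A : Matrix (Fin N) (Fin N) ℝ}

lemma measurable_quadraticForm_sphere (A : Matrix (Fin N) (Fin N) ℝ) :
    Measurable fun u : Metric.sphere (0 : EuclideanSpace ℝ (Fin N)) 1 =>
      dotProduct (WithLp.ofLp u.1) (A.mulVec (WithLp.ofLp u.1)) := by
  refine Continuous.measurable ?_
  have h : Continuous fun u : Metric.sphere (0 : EuclideanSpace ℝ (Fin N)) 1 => WithLp.ofLp u.1 :=
    (PiLp.continuous_ofLp 2 _).comp continuous_subtype_val
  exact h.dotProduct (Continuous.matrix_mulVec continuous_const h)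

lemma isProbabilityMeasure_sphereUniform (hN : N ≠ 0) : IsProbabilityMeasure (sphereUniform N) := by
  have h := lintegral_sphereUniform_quadratic hN (b := fun _ => 1) (fun _ => one_pos)
    (LinearIsometryEquiv.refl ℝ _)
  have hone : ∀ u : Metric.sphere (0 : EuclideanSpace ℝ (Fin N)) 1, ∑ i, u.1 i ^ 2 = 1 :=
    sum_sq_isometry_eq_one (LinearIsometryEquiv.refl ℝ _)
  simp [hone] at h
  exact ⟨h⟩

lemma isProbabilityMeasure_realShadow (hN : N ≠ 0) : IsProbabilityMeasure (realShadow A) := by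
  have := isProbabilityMeasure_sphereUniform hN
  exact Measure.isProbabilityMeasure_map (measurable_quadraticForm_sphere A).aemeasurable

lemma sum_mul_mem_Icc {ι : Type*} [Fintype ι] {a t : ι → ℝ} {l r : ℝ} (ht : ∀ i, 0 ≤ t i)
    (hsum : ∑ i, t i = 1) (ha : ∀ i, a i ∈ Icc l r) : ∑ i, a i * t i ∈ Icc l r := by
  constructor
  · calc l = ∑ i, l * t i := by rw [← Finset.mul_sum, hsum, mul_one]
      _ ≤ _ := Finset.sum_le_sum fun i _ => mul_le_mul_of_nonneg_right (ha i).1 (ht i)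
  · calc ∑ i, a i * t i ≤ ∑ i, r * t i :=
        Finset.sum_le_sum fun i _ => mul_le_mul_of_nonneg_right (ha i).2 (ht i)
      _ = r := by rw [← Finset.mul_sum, hsum, mul_one]

lemma realShadow_ae_mem_Icc (ha : Function.Injective a) (hA : A.IsSymm)
    (hspec : spectrum ℝ A = range a) {l r : ℝ} (hlr : ∀ i, a i ∈ Icc l r) :
    ∀ᵐ x ∂(realShadow A), x ∈ Icc l r := by
  obtain ⟨e, he⟩ := exists_isometry_quadraticForm ha hA hspec
  refine (ae_map_iff (p := fun x => x ∈ Icc l r)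
    (measurable_quadraticForm_sphere A).aemeasurable measurableSet_Icc).2
    (Eventually.of_forall fun u => ?_)
  rw [he]
  exact sum_mul_mem_Icc (fun i => sq_nonneg _) (sum_sq_isometry_eq_one e u) hlr

/-- The generalized Stieltjes transform of order `N / 2` of the real shadow. -/
theorem lintegral_realShadow (hN : N ≠ 0) (ha : Function.Injective a) (hA : A.IsSymm)
    (hspec : spectrum ℝ A = range a) {z : ℝ} (hz : ∀ i, a i < z) :
    ∫⁻ x, ENNReal.ofReal ((z - x) ^ (-((N : ℝ) / 2))) ∂(realShadow A) =
      ENNReal.ofReal (∏ i, (z - a i) ^ (-(1 / 2) : ℝ)) := by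
  obtain ⟨e, he⟩ := exists_isometry_quadraticForm ha hA hspec
  rw [← lintegral_sphereUniform_quadratic hN (b := fun i => z - a i) (fun i => sub_pos.2 (hz i)) e,
    realShadow, lintegral_map (by fun_prop) (measurable_quadraticForm_sphere A)]
  refine lintegral_congr fun u => ?_
  rw [he]
  -- The squared coordinates sum to `1`, so `z - ∑ a_i y_i² = ∑ (z - a_i) y_i²`.
  simp_rw [sub_mul, Finset.sum_sub_distrib, ← Finset.mul_sum, sum_sq_isometry_eq_one, mul_one]

end Shadow

/-! ### Gamma densities and the transform of the Dirichlet distribution. -/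

section Dirichlet

/-- The (unnormalized) Gamma density with shape `k` and rate `b`. -/
noncomputable def gammaKernel (k b y : ℝ) : ℝ :=
  (Ici (0 : ℝ)).indicator (fun y => y ^ (k - 1) * Real.exp (-(b * y))) y

lemma gammaKernel_nonneg (k b y : ℝ) : 0 ≤ gammaKernel k b y :=
  indicator_nonneg (fun _ hy => mul_nonneg (Real.rpow_nonneg hy _) (Real.exp_pos _).le) _

lemma measurable_gammaKernel (k b : ℝ) : Measurable (gammaKernel k b) :=
  (by fun_prop : Measurable fun y : ℝ => y ^ (k - 1) * Real.exp (-(b * y))).indicator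
    measurableSet_Ici

lemma integral_gammaKernel {k b : ℝ} (hk : 0 < k) (hb : 0 < b) :
    Integrable (gammaKernel k b) ∧ ∫ y, gammaKernel k b y = Real.Gamma k * b ^ (-k) := by
  have hI := Real.integral_rpow_mul_exp_neg_mul_Ioi hk hb
  have hpos : 0 < (1 / b) ^ k * Real.Gamma k := by
    have := Real.Gamma_pos_of_pos hk
    positivity
  have hval : ∫ y, gammaKernel k b y = Real.Gamma k * b ^ (-k) := by
    unfold gammaKernel
    rw [integral_indicator measurableSet_Ici, integral_Ici_eq_integral_Ioi, hI, one_div,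
      Real.inv_rpow hb.le, ← Real.rpow_neg hb.le, mul_comm]
  refine ⟨?_, hval⟩
  refine Integrable.of_integral_ne_zero (ne_of_gt ?_)
  rw [hval]
  have := Real.Gamma_pos_of_pos hk
  positivity

lemma lintegral_gammaKernel {k b : ℝ} (hk : 0 < k) (hb : 0 < b) :
    ∫⁻ y, ENNReal.ofReal (gammaKernel k b y) = ENNReal.ofReal (Real.Gamma k * b ^ (-k)) := by
  obtain ⟨h1, h2⟩ := integral_gammaKernel hk hb
  rw [← h2, ofReal_integral_eq_lintegral_ofReal h1 (Eventually.of_forall (gammaKernel_nonneg k b))]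

variable {n : ℕ}

lemma components_castSucc (t : Fin n → ℝ) (i : Fin n) :
    components (N := n + 1) t i.castSucc = t i := by
  simp [components]

lemma components_last (t : Fin n → ℝ) :
    components (N := n + 1) t (Fin.last n) = 1 - ∑ i, t i := by
  simp [components]

lemma sum_components (t : Fin n → ℝ) : ∑ i, components (N := n + 1) t i = 1 := by
  rw [Fin.sum_univ_castSucc]
  simp [components_castSucc, components_last]

lemma measurable_components (i : Fin (n + 1)) :
    Measurable fun t : Fin n → ℝ => components (N := n + 1) t i := by
  refine Fin.lastCases ?_ (fun i => ?_) i
  · simp_rw [components_last]; fun_prop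
  · simp_rw [components_castSucc]; fun_prop

lemma mem_unitSimplex_iff (t : Fin n → ℝ) :
    t ∈ unitSimplex (n + 1) ↔ ∀ i, 0 ≤ components (N := n + 1) t i := by
  constructor
  · rintro ⟨h1, h2⟩ i
    refine Fin.lastCases ?_ (fun i => ?_) i
    · rw [components_last]; exact sub_nonneg.2 h2
    · rw [components_castSucc]; exact h1 i
  · intro h
    refine ⟨fun i => ?_, ?_⟩
    · have := h (Fin.castSucc i)
      rwa [components_castSucc] at this
    · have := h (Fin.last n)
      rw [components_last] at this
      exact sub_nonneg.1 this

lemma measurableSet_unitSimplex : MeasurableSet (unitSimplex (n + 1)) := by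
  have : unitSimplex (n + 1) = ⋂ i, {t | 0 ≤ components (N := n + 1) t i} := by
    ext t
    rw [mem_iInter]
    exact mem_unitSimplex_iff t
  rw [this]
  exact MeasurableSet.iInter fun i => measurableSet_le measurable_const (measurable_components i)

/-- In the coordinates `y = r T` the Gamma densities separate into the Dirichlet weight and a single
Gamma density in `r` of shape `∑ k_i`. The Jacobian `r ^ n` fits since `n + ∑ (k_i - 1) = ∑ k_i - 1`
over `n + 1` indices. -/
lemma prod_gammaKernel_smul_components (k b : Fin (n + 1) → ℝ) (t : Fin n → ℝ) {r : ℝ}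
    (hr : 0 < r) :
    r ^ n * ∏ i, gammaKernel (k i) (b i) (r * components (N := n + 1) t i) =
      (unitSimplex (n + 1)).indicator (fun t => ∏ i, components (N := n + 1) t i ^ (k i - 1)) t *
        gammaKernel (∑ i, k i) (∑ i, b i * components (N := n + 1) t i) r := by
  by_cases ht : t ∈ unitSimplex (n + 1)
  · have hc := (mem_unitSimplex_iff t).1 ht
    have h1 : ∀ i, gammaKernel (k i) (b i) (r * components (N := n + 1) t i) =
        r ^ (k i - 1) * components (N := n + 1) t i ^ (k i - 1) *
          Real.exp (-(b i * components (N := n + 1) t i * r)) := by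
      intro i
      rw [gammaKernel, indicator_of_mem (mem_Ici.2 (mul_nonneg hr.le (hc i))),
        Real.mul_rpow hr.le (hc i)]
      congr 3
      ring
    rw [indicator_of_mem ht, gammaKernel, indicator_of_mem (mem_Ici.2 hr.le)]
    simp_rw [h1, Finset.prod_mul_distrib, ← Real.exp_sum, Finset.sum_neg_distrib,
      ← Finset.sum_mul]
    rw [← Real.rpow_sum_of_pos hr, Finset.sum_sub_distrib]
    have hpow : r ^ n * r ^ (∑ i, k i - ∑ _i : Fin (n + 1), (1 : ℝ)) = r ^ (∑ i, k i - 1) := by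
      rw [← Real.rpow_natCast, ← Real.rpow_add hr]
      congr 1
      simp
      ring
    rw [← hpow]
    ring
  · rw [indicator_of_notMem ht, zero_mul]
    rw [mem_unitSimplex_iff] at ht
    push Not at ht
    obtain ⟨i, hi⟩ := ht
    rw [Finset.prod_eq_zero (Finset.mem_univ i), mul_zero]
    rw [gammaKernel, indicator_of_notMem]
    simpa using mul_neg_of_pos_of_neg hr hi

lemma lintegral_comp_smul_pi (G : (Fin n → ℝ) → ENNReal) (hG : Measurable G) {r : ℝ} (hr : 0 < r) :
    ∫⁻ t, G t = ENNReal.ofReal (r ^ n) * ∫⁻ t, G (r • t) := by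
  have h := Measure.map_addHaar_smul (volume : Measure (Fin n → ℝ)) hr.ne'
  rw [Module.finrank_fin_fun, abs_of_pos (by positivity)] at h
  have h2 : ∫⁻ t, G (r • t) = ∫⁻ t, G t ∂(Measure.map (r • ·) volume) :=
    (lintegral_map hG (measurable_const_smul r)).symm
  rw [h2, h, lintegral_smul_measure, smul_eq_mul, ← mul_assoc, ← ENNReal.ofReal_mul (by positivity),
    mul_inv_cancel₀ (by positivity), ENNReal.ofReal_one, one_mul]

/-- Integration over `ℝ^(n+1)` in terms of the sum of the coordinates and the point of the
simplex. -/
lemma lintegral_eq_lintegral_components {F : (Fin (n + 1) → ℝ) → ENNReal} (hF : Measurable F)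
    (hsupp : ∀ y, F y ≠ 0 → ∀ i, 0 ≤ y i) :
    ∫⁻ y, F y = ∫⁻ t : Fin n → ℝ, ∫⁻ r in Ioi (0 : ℝ),
      ENNReal.ofReal (r ^ n) * F fun i => r * components (N := n + 1) t i := by
  have hmp := (volume_preserving_piFinSuccAbove (fun _ : Fin (n + 1) => ℝ) (Fin.last n)).symm
  set φ : (Fin n → ℝ) → ℝ → (Fin (n + 1) → ℝ) := fun t s => Fin.snoc (α := fun _ => ℝ) t s with hφ
  have hφm : Measurable fun x : (Fin n → ℝ) × ℝ => φ x.1 x.2 := by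
    rw [measurable_pi_iff]
    intro i
    refine Fin.lastCases ?_ (fun i => ?_) i
    · simpa [hφ] using measurable_snd
    · simp only [hφ, Fin.snoc_castSucc]; fun_prop
  have h1 : ∫⁻ y, F y = ∫⁻ t, ∫⁻ s, F (φ t s) := by
    rw [← hmp.lintegral_comp hF, Measure.volume_eq_prod]
    refine (lintegral_prod_symm' _ (hF.comp hmp.measurable)).trans ?_
    refine lintegral_congr fun t => lintegral_congr fun s => ?_
    exact congrArg F (Fin.insertNth_last' s t)
  -- For fixed `t`, translation replaces the last coordinate by the sum `r` of all coordinates.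
  have h2 : ∫⁻ y, F y = ∫⁻ r, ∫⁻ t, F (φ t (r - ∑ i, t i)) := by
    rw [h1, lintegral_lintegral_swap]
    · rw [lintegral_lintegral_swap (f := fun r t => F (φ t (r - ∑ i, t i)))]
      · rw [lintegral_lintegral_swap]
        · refine lintegral_congr fun t => ?_
          exact (lintegral_sub_right_eq_self (fun s => F (φ t s)) _).symm
        · exact (hF.comp (hφm.comp measurable_swap)).aemeasurable
      · exact (hF.comp (hφm.comp (measurable_snd.prodMk
          (measurable_fst.sub (by fun_prop))))).aemeasurable
    · exact (hF.comp hφm).aemeasurable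
  have hzero : ∀ r < 0, ∀ t : Fin n → ℝ, F (φ t (r - ∑ i, t i)) = 0 := by
    intro r hr t
    by_contra hne
    have hnn := hsupp _ hne
    have hlast := hnn (Fin.last n)
    simp only [hφ, Fin.snoc_last] at hlast
    have : 0 ≤ ∑ i, t i := Finset.sum_nonneg fun i _ => by simpa [hφ] using hnn i.castSucc
    linarith
  have h3 : ∫⁻ y, F y = ∫⁻ r in Ioi (0 : ℝ), ∫⁻ t, F (φ t (r - ∑ i, t i)) := by
    rw [h2, ← setLIntegral_congr (Ioi_ae_eq_Ici (a := (0 : ℝ))).symm,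
      setLIntegral_eq_of_support_subset]
    intro r hr
    by_contra hneg
    exact hr (by simp [hzero r (not_le.1 hneg)])
  have hswap : ∫⁻ t : Fin n → ℝ, ∫⁻ r in Ioi (0 : ℝ),
      ENNReal.ofReal (r ^ n) * F (fun i => r * components (N := n + 1) t i) =
      ∫⁻ r in Ioi (0 : ℝ), ∫⁻ t : Fin n → ℝ,
        ENNReal.ofReal (r ^ n) * F (fun i => r * components (N := n + 1) t i) := by
    refine lintegral_lintegral_swap (Measurable.aemeasurable ?_)
    refine Measurable.mul (by fun_prop) (hF.comp ?_)
    rw [measurable_pi_iff]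
    exact fun i => measurable_snd.mul ((measurable_components i).comp measurable_fst)
  rw [h3, hswap]
  refine setLIntegral_congr_fun measurableSet_Ioi fun r hr => ?_
  have hr : 0 < r := hr
  have hGm : Measurable fun t : Fin n → ℝ => F (φ t (r - ∑ i, t i)) :=
    hF.comp (hφm.comp (measurable_id.prodMk (by fun_prop)))
  -- After scaling `t` by `r`, the last coordinate becomes `r - ∑ r t_i = r T_N`.
  rw [lintegral_comp_smul_pi _ hGm hr, ← lintegral_const_mul' _ _ ENNReal.ofReal_ne_top]
  refine lintegral_congr fun t => ?_
  congr 2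
  ext i
  refine Fin.lastCases ?_ (fun i => ?_) i
  · simp [hφ, components_last, mul_sub, Finset.mul_sum]
  · simp [hφ, components_castSucc]

/-- The transform of the Dirichlet distribution. -/
theorem lintegral_dirichletMeasure {k b : Fin (n + 1) → ℝ} (hk : ∀ i, 0 < k i)
    (hb : ∀ i, 0 < b i) :
    ∫⁻ t, ENNReal.ofReal ((∑ i, b i * components (N := n + 1) t i) ^ (-∑ i, k i))
        ∂(dirichletMeasure k) = ENNReal.ofReal (∏ i, b i ^ (-(k i))) := by
  set K : ℝ := ∑ i, k i with hK
  set c : Fin (n + 1) → (Fin n → ℝ) → ℝ := fun i t => components (N := n + 1) t i with hc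
  set P : ℝ := ∏ i, Real.Gamma (k i) with hP
  have hcm : ∀ i, Measurable (c i) := measurable_components
  have hPpos : 0 < P := Finset.prod_pos fun i _ => Real.Gamma_pos_of_pos (hk i)
  have hKpos : 0 < K := Finset.sum_pos (fun i _ => hk i) Finset.univ_nonempty
  have hΓ : 0 < Real.Gamma K := Real.Gamma_pos_of_pos hKpos
  have hF : Measurable fun y : Fin (n + 1) → ℝ =>
      ENNReal.ofReal (∏ i, gammaKernel (k i) (b i) (y i)) :=
    ENNReal.measurable_ofReal.comp (Finset.measurable_fun_prod _ fun i _ =>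
      (measurable_gammaKernel _ _).comp (measurable_pi_apply i))
  have hsupp : ∀ y : Fin (n + 1) → ℝ, ENNReal.ofReal (∏ i, gammaKernel (k i) (b i) (y i)) ≠ 0 →
      ∀ i, 0 ≤ y i := by
    intro y hy i
    by_contra hneg
    refine hy ?_
    rw [Finset.prod_eq_zero (Finset.mem_univ i), ENNReal.ofReal_zero]
    rw [gammaKernel, indicator_of_notMem]
    exact hneg
  have h1 := lintegral_eq_lintegral_components hF hsupp
  rw [lintegral_ofReal_fintype_prod (fun i => (integral_gammaKernel (hk i) (hb i)).1)
    (fun i => gammaKernel_nonneg _ _)] at h1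
  simp_rw [fun i => (integral_gammaKernel (hk i) (hb i)).2] at h1
  -- The `r`-integral is a Gamma integral of rate `∑ b_i T_i`, which produces the power `-K`.
  have h2 : ∀ t : Fin n → ℝ, ∫⁻ r in Ioi (0 : ℝ), ENNReal.ofReal (r ^ n) *
      ENNReal.ofReal (∏ i, gammaKernel (k i) (b i) (r * components (N := n + 1) t i)) =
      (unitSimplex (n + 1)).indicator (fun t => ENNReal.ofReal (∏ i, c i t ^ (k i - 1)) *
        ENNReal.ofReal (Real.Gamma K * (∑ i, b i * c i t) ^ (-K))) t := by
    intro t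
    have hstep : ∀ r ∈ Ioi (0 : ℝ), ENNReal.ofReal (r ^ n) *
        ENNReal.ofReal (∏ i, gammaKernel (k i) (b i) (r * components (N := n + 1) t i)) =
        ENNReal.ofReal ((unitSimplex (n + 1)).indicator (fun t => ∏ i, c i t ^ (k i - 1)) t) *
          ENNReal.ofReal (gammaKernel K (∑ i, b i * c i t) r) := by
      intro r hr
      rw [← ENNReal.ofReal_mul (pow_nonneg (le_of_lt hr) _),
        prod_gammaKernel_smul_components k b t hr, ENNReal.ofReal_mul]
      refine indicator_nonneg (fun t ht => Finset.prod_nonneg fun i _ => Real.rpow_nonneg ?_ _) _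
      exact (mem_unitSimplex_iff t).1 ht i
    rw [setLIntegral_congr_fun measurableSet_Ioi hstep, lintegral_const_mul _
      (measurable_gammaKernel _ _).ennreal_ofReal]
    by_cases ht : t ∈ unitSimplex (n + 1)
    · rw [indicator_of_mem ht, indicator_of_mem ht]
      have hnn := (mem_unitSimplex_iff t).1 ht
      -- The components are nonnegative and sum to `1`, so they cannot all vanish.
      have hB : 0 < ∑ i, b i * c i t := by
        refine Finset.sum_pos' (fun i _ => mul_nonneg (hb i).le (hnn i)) ?_
        by_contra hcon
        push Not at hcon
        have hz : ∀ i, c i t = 0 := fun i => by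
          have h0 := hcon i (Finset.mem_univ i)
          have : c i t ≤ 0 := nonpos_of_mul_nonpos_right h0 (hb i)
          exact le_antisymm this (hnn i)
        have hone := sum_components t
        simp [show ∀ i, components (N := n + 1) t i = 0 from hz] at hone
      rw [← lintegral_gammaKernel hKpos hB,
        setLIntegral_congr (Ioi_ae_eq_Ici (a := (0 : ℝ))), setLIntegral_eq_of_support_subset]
      intro r hr
      by_contra hneg
      refine hr ?_
      change ENNReal.ofReal (gammaKernel _ _ r) = 0
      rw [gammaKernel, indicator_of_notMem hneg, ENNReal.ofReal_zero]
    · rw [indicator_of_notMem ht, indicator_of_notMem ht, ENNReal.ofReal_zero, zero_mul]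
  have h1 := h1.trans ((lintegral_congr h2).trans
    (lintegral_indicator (measurableSet_unitSimplex (n := n)) _))
  have hDm : Measurable fun t : Fin n → ℝ =>
      ENNReal.ofReal (Real.Gamma K / P * ∏ i, components (N := n + 1) t i ^ (k i - 1)) := by
    refine ENNReal.measurable_ofReal.comp (measurable_const.mul
      (Finset.measurable_fun_prod _ fun i _ => ?_))
    exact (hcm i).pow_const _
  have hgm : Measurable fun t : Fin n → ℝ =>
      ENNReal.ofReal ((∑ i, b i * components (N := n + 1) t i) ^ (-K)) := by
    refine ENNReal.measurable_ofReal.comp (Measurable.pow_const ?_ _)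
    exact Finset.measurable_fun_sum _ fun i _ => measurable_const.mul (hcm i)
  have h3 : ∫⁻ t, ENNReal.ofReal ((∑ i, b i * components (N := n + 1) t i) ^ (-K))
        ∂(dirichletMeasure k) = ENNReal.ofReal P⁻¹ * ENNReal.ofReal
          (∏ i, Real.Gamma (k i) * b i ^ (-(k i))) := by
    rw [h1, dirichletMeasure]
    refine (lintegral_withDensity_eq_lintegral_mul _ hDm hgm).trans ?_
    rw [← lintegral_const_mul']
    · refine setLIntegral_congr_fun measurableSet_unitSimplex fun t ht => ?_
      have hnn := (mem_unitSimplex_iff t).1 ht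
      have hprod : 0 ≤ ∏ i, c i t ^ (k i - 1) :=
        Finset.prod_nonneg fun i _ => Real.rpow_nonneg (hnn i) _
      simp only [Pi.mul_apply]
      rw [← ENNReal.ofReal_mul (by positivity), ← ENNReal.ofReal_mul hprod,
        ← ENNReal.ofReal_mul (by positivity)]
      congr 1
      simp only [hc]
      ring
    · exact ENNReal.ofReal_ne_top
  rw [h3, ← ENNReal.ofReal_mul (by positivity), Finset.prod_mul_distrib, ← mul_assoc,
    inv_mul_cancel₀ hPpos.ne', one_mul]

end Dirichlet

lemma integral_rpow_sub_eq_toReal {μ : Measure ℝ} {a b : ℝ} (hμ : ∀ᵐ x ∂μ, x ∈ Icc a b)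
    {p z : ℝ} (hz : b < z) :
    ∫ x, (z - x) ^ (-p) ∂μ = (∫⁻ x, ENNReal.ofReal ((z - x) ^ (-p)) ∂μ).toReal := by
  refine integral_eq_lintegral_of_nonneg_ae ?_ (by fun_prop : Measurable _).aestronglyMeasurable
  filter_upwards [hμ] with x hx using Real.rpow_nonneg (by linarith [hx.2]) _

/-! ### The transform of the Dirichlet average. -/

section DirichletAverage

variable {n : ℕ}

lemma measurable_sum_mul_components (a : Fin (n + 1) → ℝ) :
    Measurable fun t : Fin n → ℝ => ∑ i, a i * components (N := n + 1) t i :=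
  Finset.measurable_fun_sum _ fun i _ => measurable_const.mul (measurable_components i)

lemma isProbabilityMeasure_dirichletMeasure {k : Fin (n + 1) → ℝ} (hk : ∀ i, 0 < k i) :
    IsProbabilityMeasure (dirichletMeasure k) := by
  have h := lintegral_dirichletMeasure hk (b := fun _ => 1) fun _ => one_pos
  simp [sum_components] at h
  exact ⟨h⟩

lemma isProbabilityMeasure_dirichletAverage (a : Fin (n + 1) → ℝ) {k : Fin (n + 1) → ℝ}
    (hk : ∀ i, 0 < k i) : IsProbabilityMeasure (dirichletAverage a k) := by
  have := isProbabilityMeasure_dirichletMeasure hk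
  exact Measure.isProbabilityMeasure_map (measurable_sum_mul_components a).aemeasurable

lemma dirichletAverage_ae_mem_Icc {a : Fin (n + 1) → ℝ} (k : Fin (n + 1) → ℝ) {l r : ℝ}
    (hlr : ∀ i, a i ∈ Icc l r) : ∀ᵐ x ∂(dirichletAverage a k), x ∈ Icc l r := by
  refine (ae_map_iff (p := fun x => x ∈ Icc l r)
    (measurable_sum_mul_components a).aemeasurable measurableSet_Icc).2 ?_
  have h : ∀ᵐ t ∂(dirichletMeasure k), t ∈ unitSimplex (n + 1) :=
    (withDensity_absolutelyContinuous _ _).ae_le (ae_restrict_mem measurableSet_unitSimplex)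
  filter_upwards [h] with t ht
  exact sum_mul_mem_Icc ((mem_unitSimplex_iff t).1 ht) (sum_components t) hlr

/-- The generalized Stieltjes transform of a Dirichlet average. -/
theorem lintegral_dirichletAverage {a k : Fin (n + 1) → ℝ} (hk : ∀ i, 0 < k i) {z : ℝ}
    (hz : ∀ i, a i < z) :
    ∫⁻ x, ENNReal.ofReal ((z - x) ^ (-∑ i, k i)) ∂(dirichletAverage a k) =
      ENNReal.ofReal (∏ i, (z - a i) ^ (-(k i))) := by
  rw [← lintegral_dirichletMeasure hk (b := fun i => z - a i) (fun i => sub_pos.2 (hz i))]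
  refine (lintegral_map (by fun_prop) (measurable_sum_mul_components a)).trans ?_
  refine lintegral_congr fun t => ?_
  simp_rw [sub_mul, Finset.sum_sub_distrib, ← Finset.mul_sum, sum_components, mul_one]

end DirichletAverage

/-! ### Consequences of uniqueness: equality of the laws, recognition of a density. -/

/-- The real shadow of a symmetric matrix with simple spectrum is a Dirichlet average. -/
theorem realShadow_eq_dirichletAverage {N : ℕ} (hN : N ≠ 0) {a : Fin N → ℝ}
    (ha : Function.Injective a) {A : Matrix (Fin N) (Fin N) ℝ} (hA : A.IsSymm)
    (hspec : spectrum ℝ A = range a) : realShadow A = dirichletAverage a fun _ => 1 / 2 := by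
  obtain ⟨n, rfl⟩ := Nat.exists_eq_succ_of_ne_zero hN
  have hk : ∀ _ : Fin (n + 1), (0 : ℝ) < 1 / 2 := fun _ => by norm_num
  obtain ⟨i₀, hi₀⟩ := Finite.exists_min a
  obtain ⟨i₁, hi₁⟩ := Finite.exists_max a
  have hlr : ∀ i, a i ∈ Icc (a i₀) (a i₁) := fun i => ⟨hi₀ i, hi₁ i⟩
  have h1 := isProbabilityMeasure_realShadow (A := A) hN
  have h2 := isProbabilityMeasure_dirichletAverage a hk
  have hae1 := realShadow_ae_mem_Icc ha hA hspec hlr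
  have hae2 := dirichletAverage_ae_mem_Icc (fun _ => 1 / 2) hlr
  refine measure_eq_of_integral_rpow_sub_eq (hi₀ i₁) hae1 hae2
    (p := ((n + 1 : ℕ) : ℝ) / 2) (by positivity) fun z hz => ?_
  have hz' : ∀ i, a i < z := fun i => (hi₁ i).trans_lt hz
  rw [integral_rpow_sub_eq_toReal hae1 hz, integral_rpow_sub_eq_toReal hae2 hz,
    lintegral_realShadow hN ha hA hspec hz']
  have h := lintegral_dirichletAverage hk hz'
  -- The parameters `1/2` sum to `N/2`, so both transforms have the same order.
  rw [show ∑ _i : Fin (n + 1), (1 / 2 : ℝ) = ((n + 1 : ℕ) : ℝ) / 2 by simp; ring] at h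
  rw [h]

/-- A function carried by `[a, b]` with the generalized Stieltjes transform of a measure is a
density of that measure. -/
theorem isDensityOf_of_integral_rpow_sub {μ : Measure ℝ} [IsFiniteMeasure μ] {f : ℝ → ℝ} {a b : ℝ}
    (hab : a ≤ b) (hμ : ∀ᵐ x ∂μ, x ∈ Icc a b) (hf : Integrable f)
    (hsupp : ∀ x, x ∉ Icc a b → f x = 0) {p : ℝ} (hp : 0 < p)
    (h : ∀ z, b < z → ∫ x, (z - x) ^ (-p) ∂μ = ∫ x, f x * (z - x) ^ (-p)) : IsDensityOf f μ := by
  set P : Measure ℝ := volume.withDensity fun x => ENNReal.ofReal (f x) with hP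
  set M : Measure ℝ := volume.withDensity fun x => ENNReal.ofReal (-f x) with hM
  have hPfin : IsFiniteMeasure P := isFiniteMeasure_withDensity_ofReal hf.2
  have hMfin : IsFiniteMeasure M := isFiniteMeasure_withDensity_ofReal hf.neg.2
  have hmeas1 : AEMeasurable fun x => ENNReal.ofReal (f x) := hf.1.aemeasurable.ennreal_ofReal
  have hmeas2 : AEMeasurable fun x => ENNReal.ofReal (-f x) := hf.1.aemeasurable.neg.ennreal_ofReal
  have haeP : ∀ᵐ x ∂P, x ∈ Icc a b := by
    rw [hP, ae_withDensity_iff' hmeas1]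
    refine Eventually.of_forall fun x hx => ?_
    by_contra hcon
    exact hx (by simp [hsupp x hcon])
  have haeM : ∀ᵐ x ∂M, x ∈ Icc a b := by
    rw [hM, ae_withDensity_iff' hmeas2]
    refine Eventually.of_forall fun x hx => ?_
    by_contra hcon
    exact hx (by simp [hsupp x hcon])
  -- Uniqueness is about positive measures, so the negative part of `f` is moved to the side of `μ`.
  have heq : μ + M = P := by
    refine measure_eq_of_integral_rpow_sub_eq hab (ae_add_measure_iff.2 ⟨hμ, haeM⟩) haeP hp
      fun z hz => ?_
    have hIP := integrable_rpow_sub_of_ae_mem_Icc haeP hp.le hz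
    have hIM := integrable_rpow_sub_of_ae_mem_Icc haeM hp.le hz
    rw [integral_add_measure (integrable_rpow_sub_of_ae_mem_Icc hμ hp.le hz) hIM, h z hz]
    rw [hP, integrable_withDensity_iff_integrable_smul₀' hmeas1
      (Eventually.of_forall fun _ => ENNReal.ofReal_lt_top)] at hIP
    rw [hM, integrable_withDensity_iff_integrable_smul₀' hmeas2
      (Eventually.of_forall fun _ => ENNReal.ofReal_lt_top)] at hIM
    rw [hP, hM, integral_withDensity_eq_integral_toReal_smul₀ hmeas1
      (Eventually.of_forall fun _ => ENNReal.ofReal_lt_top),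
      integral_withDensity_eq_integral_toReal_smul₀ hmeas2
      (Eventually.of_forall fun _ => ENNReal.ofReal_lt_top), ← eq_sub_iff_add_eq,
      ← integral_sub hIP hIM]
    refine integral_congr_ae (Eventually.of_forall fun x => ?_)
    simp only [smul_eq_mul, ← sub_mul]
    congr 1
    rcases le_total 0 (f x) with h0 | h0
    · rw [ENNReal.toReal_ofReal h0, ENNReal.ofReal_of_nonpos (by linarith)]; simp
    · rw [ENNReal.toReal_ofReal (by linarith : 0 ≤ -f x), ENNReal.ofReal_of_nonpos h0]; simp
  -- `P` vanishes on `{f < 0}` and `M` lives there; `M ≤ P` then forces `M = 0`. A measurable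
  -- representative `f'` makes the set measurable.
  have hMzero : M = 0 := by
    obtain ⟨s, hs, hs1, hs2⟩ : ∃ s, MeasurableSet s ∧ M sᶜ = 0 ∧ P s = 0 := by
      obtain ⟨f', hf', hff'⟩ := hf.1.aemeasurable
      refine ⟨{x | f' x < 0}, measurableSet_lt hf' measurable_const, ?_, ?_⟩
      · rw [hM, withDensity_apply _ (measurableSet_lt hf' measurable_const).compl]
        rw [setLIntegral_congr_fun_ae (g := fun _ => 0)
          (measurableSet_lt hf' measurable_const).compl]
        · simp
        · filter_upwards [hff'] with x hx hxs
          have : 0 ≤ f' x := not_lt.1 hxs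
          exact ENNReal.ofReal_of_nonpos (by linarith)
      · rw [hP, withDensity_apply _ (measurableSet_lt hf' measurable_const)]
        rw [setLIntegral_congr_fun_ae (g := fun _ => 0) (measurableSet_lt hf' measurable_const)]
        · simp
        · filter_upwards [hff'] with x hx hxs
          have : f' x < 0 := hxs
          exact ENNReal.ofReal_of_nonpos (by linarith)
    have hMs : M s = 0 := by
      have := congrArg (fun m : Measure ℝ => m s) heq
      simp only [Measure.add_apply, hs2] at this
      exact (add_eq_zero.1 this).2
    rw [← Measure.measure_univ_eq_zero, ← union_compl_self s]
    exact measure_union_null hMs hs1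
  refine ⟨hf, ?_, ?_⟩
  · rw [hM, withDensity_eq_zero_iff hmeas2] at hMzero
    filter_upwards [hMzero] with x hx
    have := ENNReal.ofReal_eq_zero.1 hx
    linarith
  · rw [← hP, ← heq, hMzero, add_zero]

/-! ### Fubini for fractional integrals. -/

section FractionalIntegral

/-- Fubini for a fractional integral `∫_{s > x} g(s) (s - x)^(q-1) ds` restricted to `x ≥ α`. -/
lemma integral_fractional_mul {α q : ℝ} {S : Set ℝ} (hS : MeasurableSet S)
    {g w W : ℝ → ℝ} (hg : Measurable g) (hg0 : ∀ s ∈ S, 0 ≤ g s) (hw : Measurable w)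
    (hw0 : ∀ s ∈ S, ∀ x ∈ Ico α s, 0 ≤ w x)
    (hW : ∀ s ∈ S, IntegrableOn (fun x => (s - x) ^ (q - 1) * w x) (Ico α s) ∧
      ∫ x in Ico α s, (s - x) ^ (q - 1) * w x = W s)
    (hgW : IntegrableOn (fun s => g s * W s) S) :
    Integrable (fun x => (Ici α).indicator
      (fun x => ∫ s in S ∩ Ioi x, g s * (s - x) ^ (q - 1)) x * w x) ∧
    ∫ x, (Ici α).indicator (fun x => ∫ s in S ∩ Ioi x, g s * (s - x) ^ (q - 1)) x * w x =
      ∫ s in S, g s * W s := by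
  set k : ℝ × ℝ → ℝ := fun y =>
    ({y : ℝ × ℝ | y.2 < y.1}.indicator fun y => g y.1 * (y.1 - y.2) ^ (q - 1) * w y.2) y with hk
  have hkm : Measurable k := by
    refine Measurable.indicator ?_ (measurableSet_lt measurable_snd measurable_fst)
    exact ((hg.comp measurable_fst).mul ((measurable_fst.sub measurable_snd).pow_const _)).mul
      (hw.comp measurable_snd)
  have hslice : ∀ s, (fun x => k (s, x)) =
      (Iio s).indicator fun x => g s * ((s - x) ^ (q - 1) * w x) := by
    intro s
    ext x
    simp only [hk, indicator, mem_ofPred_eq, mem_Iio, mul_assoc]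
  have hmeas : ∀ s, (volume.restrict (Ici α)).restrict (Iio s) = volume.restrict (Ico α s) := by
    intro s
    rw [Measure.restrict_restrict measurableSet_Iio, inter_comm, Ici_inter_Iio]
  have hinner : ∀ s ∈ S, Integrable (fun x => k (s, x)) (volume.restrict (Ici α)) := by
    intro s hs
    rw [hslice, integrable_indicator_iff measurableSet_Iio, IntegrableOn, hmeas]
    exact (hW s hs).1.const_mul _
  have hval : ∀ s ∈ S, ∫ x in Ici α, k (s, x) = g s * W s := by
    intro s hs
    rw [hslice, integral_indicator measurableSet_Iio, hmeas, integral_const_mul, (hW s hs).2]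
  have hnn : ∀ s ∈ S, ∀ x ∈ Ici α, 0 ≤ k (s, x) := by
    intro s hs x hx
    refine indicator_apply_nonneg fun hxs => ?_
    have hxs : x < s := hxs
    exact mul_nonneg (mul_nonneg (hg0 s hs) (Real.rpow_nonneg (by simpa using hxs.le) _))
      (hw0 s hs x ⟨hx, hxs⟩)
  -- By nonnegativity the slice integrals of `‖k‖` are `g s * W s`, so `hgW` gives integrability on
  -- the product.
  have hint : Integrable k ((volume.restrict S).prod (volume.restrict (Ici α))) := by
    rw [integrable_prod_iff hkm.aestronglyMeasurable]
    refine ⟨(ae_restrict_mem hS).mono hinner, hgW.congr ?_⟩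
    filter_upwards [ae_restrict_mem hS] with s hs
    rw [← hval s hs]
    refine setIntegral_congr_fun measurableSet_Ici fun x hx => ?_
    exact (Real.norm_of_nonneg (hnn s hs x hx)).symm
  have hleft : ∀ x, ∫ s in S, k (s, x) = (∫ s in S ∩ Ioi x, g s * (s - x) ^ (q - 1)) * w x := by
    intro x
    have : (fun s => k (s, x)) = (Ioi x).indicator fun s => g s * (s - x) ^ (q - 1) * w x := by
      ext s
      simp only [hk, indicator, mem_ofPred_eq, mem_Ioi]
    rw [this, integral_indicator measurableSet_Ioi, Measure.restrict_restrict measurableSet_Ioi,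
      inter_comm, integral_mul_const]
  have hfun : (fun x => (Ici α).indicator
      (fun x => ∫ s in S ∩ Ioi x, g s * (s - x) ^ (q - 1)) x * w x) =
      (Ici α).indicator fun x => ∫ s in S, k (s, x) := by
    ext x
    by_cases hx : x ∈ Ici α
    · rw [indicator_of_mem hx, indicator_of_mem hx, hleft]
    · rw [indicator_of_notMem hx, indicator_of_notMem hx, zero_mul]
  rw [hfun, integrable_indicator_iff measurableSet_Ici, integral_indicator measurableSet_Ici]
  refine ⟨hint.integral_prod_right, ?_⟩
  rw [← setIntegral_congr_fun hS hval]
  exact (integral_integral_swap hint).symm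

lemma integrableOn_sub_rpow {α s q : ℝ} (hq : 0 < q) (hαs : α < s) :
    IntegrableOn (fun x => (s - x) ^ (q - 1)) (Ico α s) := by
  have h : IntervalIntegrable (fun x : ℝ => x ^ (q - 1)) volume (s - α) (s - s) :=
    intervalIntegral.intervalIntegrable_rpow' (by linarith)
  have h2 := h.comp_sub_left s
  simp only [sub_sub_cancel] at h2
  exact ((intervalIntegrable_iff_integrableOn_Ico_of_le hαs.le).1 h2)

lemma integral_sub_rpow {α s q : ℝ} (hq : 0 < q) (hαs : α < s) :
    ∫ x in Ico α s, (s - x) ^ (q - 1) = (s - α) ^ q / q := by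
  rw [integral_Ico_eq_integral_Ioc, ← intervalIntegral.integral_of_le hαs.le,
    intervalIntegral.integral_comp_sub_left (fun x => x ^ (q - 1)) s,
    integral_rpow (Or.inl (by linarith)), sub_self, sub_add_cancel, Real.zero_rpow hq.ne', sub_zero]

/-- As `((s - x)/(z - x))' = -(z - s)/(z - x)²`, the integrand is a constant multiple of the
derivative of `((s - x)/(z - x))^q`: the exponents `q - 1` and `-(q + 1)` are exactly matched. -/
lemma integral_sub_rpow_mul_sub_rpow {α s z q : ℝ} (hq : 0 < q) (hαs : α < s) (hsz : s < z) :
    IntegrableOn (fun x => (s - x) ^ (q - 1) * (z - x) ^ (-(q + 1))) (Ico α s) ∧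
    ∫ x in Ico α s, (s - x) ^ (q - 1) * (z - x) ^ (-(q + 1)) =
      (s - α) ^ q / (q * (z - s) * (z - α) ^ q) := by
  have hint : IntegrableOn (fun x => (s - x) ^ (q - 1) * (z - x) ^ (-(q + 1))) (Icc α s) := by
    refine IntegrableOn.mul_continuousOn
      ((integrableOn_Icc_iff_integrableOn_Ico enorm_ne_top).2 (integrableOn_sub_rpow hq hαs)) ?_
      isCompact_Icc
    refine ContinuousOn.rpow_const (by fun_prop) fun x hx => Or.inl ?_
    linarith [hx.2]
  refine ⟨hint.mono_set Ico_subset_Icc_self, ?_⟩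
  rw [integral_Ico_eq_integral_Ioc, ← intervalIntegral.integral_of_le hαs.le]
  set Θ : ℝ → ℝ := fun x => -((s - x) ^ q * (z - x) ^ (-q)) / (q * (z - s)) with hΘ
  have hcont : ContinuousOn Θ (Icc α s) := by
    refine ContinuousOn.div_const (ContinuousOn.neg (ContinuousOn.mul ?_ ?_)) _
    · exact ContinuousOn.rpow_const (by fun_prop) fun x _ => Or.inr hq.le
    · exact ContinuousOn.rpow_const (by fun_prop) fun x hx => Or.inl (by linarith [hx.2])
  have hderiv : ∀ x ∈ Ioo α s,
      HasDerivAt Θ ((s - x) ^ (q - 1) * (z - x) ^ (-(q + 1))) x := by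
    intro x hx
    have h1 : 0 < s - x := by linarith [hx.2]
    have h2 : 0 < z - x := by linarith [hx.2]
    have d1 := ((hasDerivAt_id x).const_sub s).rpow_const (p := q) (Or.inl h1.ne')
    have d2 := ((hasDerivAt_id x).const_sub z).rpow_const (p := -q) (Or.inl h2.ne')
    refine ((d1.mul d2).neg.div_const (q * (z - s))).congr_deriv ?_
    simp only [id]
    have e1 : (s - x) ^ q = (s - x) ^ (q - 1) * (s - x) := by
      rw [← Real.rpow_add_one h1.ne', sub_add_cancel]
    have e2 : (z - x) ^ (-q) = (z - x) ^ (-(q + 1)) * (z - x) := by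
      rw [← Real.rpow_add_one h2.ne']; congr 1; ring
    have e3 : (z - x) ^ (-q - 1) = (z - x) ^ (-(q + 1)) := by congr 1; ring
    rw [e1, e2, e3]
    have hzs : z - s ≠ 0 := by linarith
    field_simp
    ring
  rw [intervalIntegral.integral_eq_sub_of_hasDerivAt_of_le hαs.le hcont hderiv
    ((intervalIntegrable_iff_integrableOn_Icc_of_le hαs.le).2 hint)]
  simp only [hΘ, sub_self, Real.zero_rpow hq.ne', zero_mul, neg_zero, zero_div, zero_sub]
  rw [Real.rpow_neg (by linarith)]
  have h3 : (z - α) ^ q ≠ 0 := (Real.rpow_pos_of_pos (by linarith) _).ne'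
  have hzs : z - s ≠ 0 := by linarith
  field_simp

end FractionalIntegral

/-! ### Knots, kernels and absolute convergence. -/

section Knots

variable {N : ℕ} {a : Fin N → ℝ}

lemma knot_eq {i : ℕ} (h1 : 1 ≤ i) (h2 : i ≤ N) : knot a i = a ⟨i - 1, by omega⟩ :=
  dif_pos ⟨h1, h2⟩

lemma knot_lt_knot (ha : StrictMono a) {i i' : ℕ} (h1 : 1 ≤ i) (h : i < i') (h2 : i' ≤ N) :
    knot a i < knot a i' := by
  rw [knot_eq h1 (by omega), knot_eq (by omega) h2]
  exact ha (Fin.mk_lt_mk.2 (by omega))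

lemma knot_le_knot (ha : StrictMono a) {i i' : ℕ} (h1 : 1 ≤ i) (h : i ≤ i') (h2 : i' ≤ N) :
    knot a i ≤ knot a i' := by
  rcases h.eq_or_lt with rfl | h
  · rfl
  · exact (knot_lt_knot ha h1 h h2).le

lemma knot_one_le (ha : StrictMono a) (i : Fin N) : knot a 1 ≤ a i := by
  have := i.2
  rw [knot_eq le_rfl (by omega)]
  exact ha.monotone (Fin.mk_le_mk.2 (by omega))

lemma le_knot_self (ha : StrictMono a) (i : Fin N) : a i ≤ knot a N := by
  have := i.2
  rw [knot_eq (by omega) le_rfl]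
  exact ha.monotone (Fin.mk_le_mk.2 (by omega))

lemma exists_knot_interval {s : ℝ} (h1 : knot a 1 ≤ s) {m : ℕ} (hm : 1 ≤ m) (hs : s < knot a m) :
    ∃ i, 1 ≤ i ∧ i < m ∧ s ∈ Ico (knot a i) (knot a (i + 1)) := by
  induction m, hm using Nat.le_induction with
  | base => exact absurd hs (not_lt.2 h1)
  | succ m hm ih =>
    rcases lt_or_ge s (knot a m) with h | h
    · obtain ⟨i, hi1, hi2, hi3⟩ := ih h
      exact ⟨i, hi1, by omega, hi3⟩
    · exact ⟨m, hm, by omega, h, hs⟩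

lemma knot_interval_unique (ha : StrictMono a) {i i' : ℕ} {s : ℝ} (h1 : 1 ≤ i) (hi : i < N)
    (h1' : 1 ≤ i') (hi' : i' < N) (hs : s ∈ Ico (knot a i) (knot a (i + 1)))
    (hs' : s ∈ Ico (knot a i') (knot a (i' + 1))) : i = i' := by
  rcases lt_trichotomy i i' with h | h | h
  · have := knot_le_knot ha (by omega : 1 ≤ i + 1) h hi'.le
    linarith [hs.2, hs'.1]
  · exact h
  · have := knot_le_knot ha (by omega : 1 ≤ i' + 1) h hi.le
    linarith [hs'.2, hs.1]

/-- `∏ |s - aᵢ|^(-1/2)`. -/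
noncomputable def gapProd (a : Fin N → ℝ) (s : ℝ) : ℝ := ∏ i, |s - a i| ^ (-(1 / 2) : ℝ)

/-- The support interval of the `j`-th kernel. -/
def kernelInterval (a : Fin N → ℝ) (j : ℕ) : Set ℝ :=
  Ioo (knot a (N - 2 * j - 1)) (knot a (N - 2 * j))

lemma measurableSet_kernelInterval (a : Fin N → ℝ) (j : ℕ) : MeasurableSet (kernelInterval a j) :=
  measurableSet_Ioo

lemma gapProd_eq_prod_range (a : Fin N → ℝ) (s : ℝ) :
    gapProd a s = ∏ m ∈ Finset.range N, |s - knot a (N - m)| ^ (-(1 / 2) : ℝ) := by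
  rw [Finset.prod_range, gapProd, ← Equiv.prod_comp Fin.revPerm]
  refine Finset.prod_congr rfl fun i _ => ?_
  have := i.2
  rw [knot_eq (by omega) (by omega)]
  congr 4

/-- The first `2j + 1` factors belong to the knots right of the interval and the rest to those left
of it, so every base is positive there. -/
lemma shadowKernel_eq_gapProd (ha : StrictMono a) {j : ℕ} (hj : 2 * j + 2 ≤ N) {s : ℝ}
    (hs : s ∈ kernelInterval a j) : shadowKernel a j s = gapProd a s := by
  have hunion : Finset.range N = Finset.Icc 0 (2 * j) ∪ Finset.Icc (2 * j + 1) (N - 1) := by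
    ext m; simp only [Finset.mem_range, Finset.mem_union, Finset.mem_Icc]; omega
  have hdisj : Disjoint (Finset.Icc 0 (2 * j)) (Finset.Icc (2 * j + 1) (N - 1)) := by
    rw [Finset.disjoint_left]; intro m; simp only [Finset.mem_Icc]; omega
  rw [gapProd_eq_prod_range, hunion, Finset.prod_union hdisj, shadowKernel]
  congr 1
  · refine Finset.prod_congr rfl fun m hm => ?_
    rw [Finset.mem_Icc] at hm
    have := knot_le_knot ha (by omega : 1 ≤ N - 2 * j) (by omega : N - 2 * j ≤ N - m) (by omega)
    rw [abs_of_neg (by linarith [hs.2]), neg_sub]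
  · refine Finset.prod_congr rfl fun m hm => ?_
    rw [Finset.mem_Icc] at hm
    have := knot_le_knot ha (by omega : 1 ≤ N - m) (by omega : N - m ≤ N - 2 * j - 1) (by omega)
    rw [abs_of_pos (by linarith [hs.1])]

lemma gapProd_nonneg (a : Fin N → ℝ) (s : ℝ) : 0 ≤ gapProd a s :=
  Finset.prod_nonneg fun _ _ => Real.rpow_nonneg (abs_nonneg _) _

lemma measurable_shadowKernel (a : Fin N → ℝ) (j : ℕ) : Measurable (shadowKernel a j) := by
  unfold shadowKernel
  refine Measurable.mul ?_ ?_
  · exact Finset.measurable_fun_prod _ fun m _ => by fun_prop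
  · exact Finset.measurable_fun_prod _ fun m _ => by fun_prop

lemma integrableOn_shadowKernel_mul (ha : StrictMono a) {j : ℕ} (hj : 2 * j + 2 ≤ N) {φ : ℝ → ℝ}
    (hφ : ContinuousOn φ (Icc (knot a (N - 2 * j - 1)) (knot a (N - 2 * j)))) :
    IntegrableOn (fun s => shadowKernel a j s * φ s) (kernelInterval a j) := by
  have h := ((locallyIntegrable_prod_abs_sub_rpow ha.injective).integrableOn_isCompact
    isCompact_Icc).mul_continuousOn hφ isCompact_Icc
  refine (h.mono_set Ioo_subset_Icc_self).congr_fun (fun s hs => ?_) measurableSet_Ioo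
  simp only
  rw [shadowKernel_eq_gapProd ha hj hs, gapProd]

lemma continuousOn_sub_rpow_of_lt {x lo hi : ℝ} (hx : x < lo) (e : ℝ) :
    ContinuousOn (fun s : ℝ => (s - x) ^ e) (Icc lo hi) :=
  ContinuousOn.rpow_const (by fun_prop) fun s hs => Or.inl (by linarith [hs.1])

lemma continuousOn_sub_rpow_of_nonneg {x e : ℝ} (he : 0 ≤ e) (s : Set ℝ) :
    ContinuousOn (fun s : ℝ => (s - x) ^ e) s :=
  ContinuousOn.rpow_const (by fun_prop) fun s _ => Or.inr he

/-- Absolute convergence over a full interval to the right of `x`. -/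
lemma intervalIntegrable_shadowIntegrand_of_lt (ha : StrictMono a) {j : ℕ} (hj : 2 * j + 2 ≤ N)
    {x : ℝ} (hx : x < knot a (N - 2 * j - 1)) :
    IntervalIntegrable (shadowIntegrand a j x) volume (knot a (N - 2 * j - 1))
      (knot a (N - 2 * j)) := by
  rw [intervalIntegrable_iff_integrableOn_Ioo_of_le
    (knot_le_knot ha (by omega) (by omega) (by omega))]
  exact integrableOn_shadowKernel_mul ha hj (continuousOn_sub_rpow_of_lt hx _)

/-- Absolute convergence over the part of an interval to the right of `x`. -/
lemma intervalIntegrable_shadowIntegrand_of_mem (hN : 2 < N) (ha : StrictMono a) {j : ℕ}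
    (hj : 2 * j + 2 ≤ N) {x : ℝ} (hx : x ∈ Ico (knot a (N - 2 * j - 1)) (knot a (N - 2 * j)))
    (hexc : ¬ (N = 3 ∧ x = knot a 2)) :
    IntervalIntegrable (shadowIntegrand a j x) volume x (knot a (N - 2 * j)) := by
  have hsub : Ioo x (knot a (N - 2 * j)) ⊆ kernelInterval a j := Ioo_subset_Ioo_left hx.1
  rw [intervalIntegrable_iff_integrableOn_Ioo_of_le hx.2.le]
  -- For `N ≥ 4` the exponent `N/2 - 2` is nonnegative. For `N = 3` it is `-1/2` and `x` acts as a
  -- further knot, harmless when it differs from the others; at `x = a_2` the singularity would be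
  -- `(s - a_2)^(-1)`.
  rcases Nat.lt_or_ge N 4 with h4 | h4
  · obtain rfl : N = 3 := by omega
    obtain rfl : j = 0 := by omega
    have hx2 : x ≠ knot a 2 := fun h => hexc ⟨rfl, h⟩
    have hlt : knot a 2 < x := lt_of_le_of_ne hx.1 (Ne.symm hx2)
    have hne : ∀ i, a i ≠ x := by
      intro i hi
      have hi' : a i = knot a (i + 1) := by rw [knot_eq (by omega) (by omega)]; rfl
      have hi3 := i.2
      rcases Nat.lt_or_ge (i : ℕ) 2 with h | h
      · have := knot_le_knot ha (by omega : 1 ≤ (i : ℕ) + 1) (by omega : (i : ℕ) + 1 ≤ 2) (by omega)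
        linarith
      · have h2 : (i : ℕ) = 2 := by omega
        rw [h2] at hi'
        have : x < knot a 3 := hx.2
        linarith
    have hinj : Function.Injective fun o : Option (Fin 3) => o.elim x a := by
      rintro (_ | i) (_ | i') h
      · rfl
      · exact absurd h.symm (hne i')
      · exact absurd h (hne i)
      · exact congrArg some (ha.injective h)
    have h := ((locallyIntegrable_prod_abs_sub_rpow hinj).integrableOn_isCompact
      (isCompact_Icc (a := x) (b := knot a (3 - 2 * 0)))).mono_set Ioo_subset_Icc_self
    refine h.congr_fun (fun s hs => ?_) measurableSet_Ioo
    have hpos : 0 < s - x := sub_pos.2 hs.1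
    simp only [Fintype.prod_option, Option.elim]
    rw [shadowIntegrand, shadowKernel_eq_gapProd ha hj (hsub hs), gapProd, abs_of_pos hpos,
      mul_comm]
    norm_num
  · have h4' : (4 : ℝ) ≤ N := by exact_mod_cast h4
    exact (integrableOn_shadowKernel_mul ha hj
      (continuousOn_sub_rpow_of_nonneg (by linarith) _)).mono_set hsub

end Knots

/-! ### Phases of the branch kernel on the real line. -/

section BoundaryValues

variable {N : ℕ} {a : Fin N → ℝ}

/-- Left of `c` the argument is `π`, and the phase is `e^(-iπ/2) = -i`. -/
lemma cpow_sub_neg_half {s c : ℝ} (hsc : s ≠ c) :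
    ((s : ℂ) - c) ^ ((-(1 / 2) : ℝ) : ℂ) =
      ((|s - c| ^ (-(1 / 2) : ℝ) : ℝ) : ℂ) * if s < c then -Complex.I else 1 := by
  rw [← Complex.ofReal_sub]
  split_ifs with h
  · have h0 : s - c < 0 := sub_neg.2 h
    rw [Complex.ofReal_cpow_of_nonpos h0.le, abs_of_neg h0, ← Complex.ofReal_neg (s - c),
      ← Complex.ofReal_cpow (by linarith)]
    congr 1
    rw [show (Real.pi : ℂ) * Complex.I * ((-(1 / 2) : ℝ) : ℂ) = -(Real.pi / 2 * Complex.I) by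
      push_cast; ring, Complex.exp_neg, Complex.exp_pi_div_two_mul_I, Complex.inv_I]
  · have h0 : 0 < s - c := sub_pos.2 (lt_of_le_of_ne (not_lt.1 h) (Ne.symm hsc))
    rw [abs_of_pos h0, Complex.ofReal_cpow h0.le, mul_one]

lemma branchKernel_ofReal_eq {α q s : ℝ} (hs : ∀ i, s ≠ a i) :
    branchKernel a α q s = ((s : ℂ) - α) ^ (q : ℂ) * ((gapProd a s : ℝ) : ℂ) *
      (-Complex.I) ^ (Finset.univ.filter fun i => s < a i).card := by
  unfold branchKernel gapProd
  rw [Finset.prod_congr rfl fun i _ => cpow_sub_neg_half (hs i), Finset.prod_mul_distrib,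
    Finset.prod_ite, Finset.prod_const, Finset.prod_const_one, mul_one, Complex.ofReal_prod,
    mul_assoc]

lemma card_filter_lt_of_mem (ha : StrictMono a) {i : ℕ} (h1 : 1 ≤ i) (hi : i < N) {s : ℝ}
    (hs : s ∈ Ico (knot a i) (knot a (i + 1))) :
    (Finset.univ.filter fun m => s < a m).card = N - i := by
  have : (Finset.univ.filter fun m => s < a m) = Finset.Ici (⟨i, hi⟩ : Fin N) := by
    ext m
    simp only [Finset.mem_filter, Finset.mem_univ, true_and, Finset.mem_Ici]
    rw [knot_eq h1 hi.le, knot_eq (by omega) hi] at hs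
    constructor
    · intro h
      by_contra hlt
      rw [not_le, Fin.lt_def] at hlt
      have : a m ≤ a ⟨i - 1, by omega⟩ := ha.monotone (Fin.mk_le_mk.2 (by simp at hlt; omega))
      linarith [hs.1]
    · intro h
      exact hs.2.trans_le (ha.monotone h)
  rw [this, Fin.card_Ici]

lemma branchKernel_im_of_mem_even (ha : StrictMono a) {i M : ℕ} (h1 : 1 ≤ i) (hi : i < N)
    (hM : N - i = 2 * M) {q s : ℝ} (hs : s ∈ Ico (knot a i) (knot a (i + 1)))
    (hne : ∀ i, s ≠ a i) : (branchKernel a (knot a 1) q s).im = 0 := by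
  have hα : 0 ≤ s - knot a 1 := by linarith [knot_le_knot ha le_rfl h1 hi.le, hs.1]
  rw [branchKernel_ofReal_eq hne, card_filter_lt_of_mem ha h1 hi hs, hM, ← Complex.ofReal_sub,
    ← Complex.ofReal_cpow hα, pow_mul, neg_sq, Complex.I_sq]
  rw [show ((-1 : ℂ)) ^ M = (((-1 : ℝ) ^ M : ℝ) : ℂ) by push_cast; rfl]
  rw [← Complex.ofReal_mul, ← Complex.ofReal_mul, Complex.ofReal_im]

lemma branchKernel_im_of_mem_odd (ha : StrictMono a) {i M : ℕ} (h1 : 1 ≤ i) (hi : i < N)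
    (hM : N - i = 2 * M + 1) {q s : ℝ} (hs : s ∈ Ico (knot a i) (knot a (i + 1)))
    (hne : ∀ i, s ≠ a i) : (branchKernel a (knot a 1) q s).im =
      -((-1) ^ M * (gapProd a s * (s - knot a 1) ^ q)) := by
  have hα : 0 ≤ s - knot a 1 := by linarith [knot_le_knot ha le_rfl h1 hi.le, hs.1]
  rw [branchKernel_ofReal_eq hne, card_filter_lt_of_mem ha h1 hi hs, hM, ← Complex.ofReal_sub,
    ← Complex.ofReal_cpow hα, pow_succ, pow_mul, neg_sq, Complex.I_sq]
  rw [show ((-1 : ℂ)) ^ M = (((-1 : ℝ) ^ M : ℝ) : ℂ) by push_cast; rfl]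
  rw [← mul_assoc, ← Complex.ofReal_mul, ← Complex.ofReal_mul, Complex.im_ofReal_mul,
    Complex.neg_im, Complex.I_im]
  ring

lemma branchKernel_im_of_knot_lt (ha : StrictMono a) {q s : ℝ} (hN : 1 ≤ N)
    (hs : knot a N < s) : (branchKernel a (knot a 1) q s).im = 0 := by
  rw [branchKernel_ofReal, Complex.ofReal_im]
  · exact (knot_le_knot ha le_rfl hN le_rfl).trans hs.le
  · exact fun i => (le_knot_self ha i).trans hs.le

/-- Here `(w - a_1)^q` also has a phase, and the total `e^(iπq) (-i)^N` is `e^(-iπ) = -1` because `q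
= N/2 - 1`. So no half-line enters the Cauchy formula. -/
lemma branchKernel_im_of_lt_knot (ha : StrictMono a) {q s : ℝ} (hq : q + 1 = (N : ℝ) / 2)
    (hs : s < knot a 1) : (branchKernel a (knot a 1) q s).im = 0 := by
  have hlt : ∀ i, s < a i := fun i => hs.trans_le (knot_one_le ha i)
  have hneg : s - knot a 1 < 0 := sub_neg.2 hs
  rw [branchKernel_ofReal_eq fun i => (hlt i).ne, Finset.filter_true_of_mem fun i _ => hlt i,
    Finset.card_univ, Fintype.card_fin, ← Complex.ofReal_sub,
    Complex.ofReal_cpow_of_nonpos hneg.le, ← Complex.ofReal_neg,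
    ← Complex.ofReal_cpow (by linarith)]
  have hexp : Complex.exp (Real.pi * Complex.I * q) * (-Complex.I) ^ N = -1 := by
    have h2 : -Complex.I = Complex.exp (-(Real.pi / 2 * Complex.I)) := by
      rw [Complex.exp_neg, Complex.exp_pi_div_two_mul_I, Complex.inv_I]
    have hq' : (q : ℂ) = N / 2 - 1 := by
      rw [show q = (N : ℝ) / 2 - 1 by linarith]; push_cast; ring
    rw [h2, ← Complex.exp_nat_mul, ← Complex.exp_add, hq',
      show (Real.pi : ℂ) * Complex.I * (N / 2 - 1) + N * -(Real.pi / 2 * Complex.I) =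
        -(Real.pi * Complex.I) by ring, Complex.exp_neg, Complex.exp_pi_mul_I]
    norm_num
  rw [show ∀ x y z w : ℂ, x * y * z * w = x * z * (y * w) by intros; ring, hexp,
    ← Complex.ofReal_mul]
  simp

lemma notMem_kernelInterval_of_ne (ha : StrictMono a) {i j : ℕ} (h1 : 1 ≤ i) (hi : i < N)
    (hj : 2 * j + 2 ≤ N) {s : ℝ} (hs : s ∈ Ico (knot a i) (knot a (i + 1)))
    (hne : N - i ≠ 2 * j + 1) : s ∉ kernelInterval a j := by
  intro hmem
  have h := knot_interval_unique ha h1 hi (by omega : 1 ≤ N - 2 * j - 1) (by omega) hs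
    ⟨hmem.1.le, by rw [show N - 2 * j - 1 + 1 = N - 2 * j by omega]; exact hmem.2⟩
  omega

/-- The boundary values of the branch kernel in terms of the kernels `shadowKernel a j`. -/
lemma branchKernel_im_eq (hN : 2 < N) (ha : StrictMono a) {q s : ℝ} (hq : q + 1 = (N : ℝ) / 2)
    (hne : ∀ i, s ≠ a i) : (branchKernel a (knot a 1) q s).im =
      -∑ j ∈ Finset.range (N / 2), (-1) ^ j *
        (kernelInterval a j).indicator (fun s => shadowKernel a j s * (s - knot a 1) ^ q) s := by
  have hj : ∀ j ∈ Finset.range (N / 2), 2 * j + 2 ≤ N := fun j hj => by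
    rw [Finset.mem_range] at hj; omega
  rcases lt_or_ge s (knot a 1) with hlt | hge
  · rw [branchKernel_im_of_lt_knot ha hq hlt, Finset.sum_eq_zero, neg_zero]
    intro j hj'
    have := hj j hj'
    rw [indicator_of_notMem, mul_zero]
    intro hmem
    have := knot_le_knot ha le_rfl (by omega : 1 ≤ N - 2 * j - 1) (by omega)
    linarith [hmem.1]
  rcases lt_or_ge s (knot a N) with hlt' | hge'
  · obtain ⟨i, h1, hi, hs⟩ := exists_knot_interval hge (by omega : 1 ≤ N) hlt'
    rcases Nat.even_or_odd' (N - i) with ⟨M, hM | hM⟩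
    · rw [branchKernel_im_of_mem_even ha h1 hi hM hs hne, Finset.sum_eq_zero, neg_zero]
      intro j hj'
      rw [indicator_of_notMem (notMem_kernelInterval_of_ne ha h1 hi (hj j hj') hs (by omega)),
        mul_zero]
    · rw [branchKernel_im_of_mem_odd ha h1 hi hM hs hne, Finset.sum_eq_single M]
      · have hmem : s ∈ kernelInterval a M := by
          have e1 : N - 2 * M - 1 = i := by omega
          have e2 : N - 2 * M = i + 1 := by omega
          rw [kernelInterval, e1, e2]
          refine ⟨lt_of_le_of_ne hs.1 fun h => ?_, hs.2⟩
          rw [knot_eq h1 hi.le] at h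
          exact hne _ h.symm
        rw [indicator_of_mem hmem, shadowKernel_eq_gapProd ha (by omega) hmem]
      · intro j hj' hjM
        rw [indicator_of_notMem (notMem_kernelInterval_of_ne ha h1 hi (hj j hj') hs (by omega)),
          mul_zero]
      · intro hM'
        rw [Finset.mem_range] at hM'
        omega
  · have hgt : knot a N < s := by
      refine lt_of_le_of_ne hge' fun h => ?_
      rw [knot_eq (by omega) le_rfl] at h
      exact hne _ h.symm
    rw [branchKernel_im_of_knot_lt ha (by omega) hgt, Finset.sum_eq_zero, neg_zero]
    intro j hj'
    have := hj j hj'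
    rw [indicator_of_notMem, mul_zero]
    intro hmem
    have := knot_le_knot ha (by omega : 1 ≤ N - 2 * j) (by omega : N - 2 * j ≤ N) le_rfl
    linarith [hmem.2]

/-- The alternating sum of Cauchy transforms of the kernels. -/
theorem sum_integral_shadowKernel (hN : 2 < N) (ha : StrictMono a) {z : ℝ} (hz : knot a N < z) :
    ∑ j ∈ Finset.range (N / 2), (-1) ^ j * ∫ s in kernelInterval a j,
        shadowKernel a j s * ((s - knot a 1) ^ ((N : ℝ) / 2 - 1) / (z - s)) =
      Real.pi * ((z - knot a 1) ^ ((N : ℝ) / 2 - 1) * ∏ i, (z - a i) ^ (-(1 / 2) : ℝ)) := by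
  set q : ℝ := (N : ℝ) / 2 - 1 with hq
  have hN' : (3 : ℝ) ≤ N := by exact_mod_cast hN
  have hq0 : 0 ≤ q := by rw [hq]; linarith
  have hq1 : q + 1 = (N : ℝ) / 2 := by rw [hq]; ring
  have hz1 : knot a 1 < z := (knot_le_knot ha le_rfl (by omega) le_rfl).trans_lt hz
  rw [← integral_im_branchKernel_div ha.injective hz1 (fun i => (le_knot_self ha i).trans_lt hz)
    hq0 (by rw [Fintype.card_fin]; exact hq1)]
  have hne : ∀ᵐ s : ℝ, ∀ i, s ≠ a i := ae_all_iff.2 fun i => by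
    simp [ae_iff, measure_singleton]
  have hpt : (fun s : ℝ => (branchKernel a (knot a 1) q s).im / (s - z)) =ᵐ[volume]
      fun s => ∑ j ∈ Finset.range (N / 2), (-1) ^ j * (kernelInterval a j).indicator
        (fun s => shadowKernel a j s * ((s - knot a 1) ^ q / (z - s))) s := by
    filter_upwards [hne] with s hs
    rw [branchKernel_im_eq hN ha hq1 hs, neg_div, ← div_neg, neg_sub, Finset.sum_div]
    refine Finset.sum_congr rfl fun j _ => ?_
    rw [mul_div_assoc]
    congr 1
    by_cases hmem : s ∈ kernelInterval a j
    · rw [indicator_of_mem hmem, indicator_of_mem hmem, mul_div_assoc]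
    · rw [indicator_of_notMem hmem, indicator_of_notMem hmem, zero_div]
  rw [integral_congr_ae hpt, integral_finsetSum]
  · refine Finset.sum_congr rfl fun j _ => ?_
    rw [integral_const_mul, integral_indicator (measurableSet_kernelInterval a j)]
  · intro j hj
    rw [Finset.mem_range] at hj
    refine Integrable.const_mul ?_ _
    rw [integrable_indicator_iff (measurableSet_kernelInterval a j)]
    refine integrableOn_shadowKernel_mul ha (by omega) ?_
    refine (continuousOn_sub_rpow_of_nonneg hq0 _).div (by fun_prop) fun s hs => ?_
    have := knot_le_knot ha (by omega : 1 ≤ N - 2 * j) (by omega : N - 2 * j ≤ N) le_rfl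
    linarith [hs.2]

end BoundaryValues

/-! ### The density as a sum of fractional integrals, and its transform. -/

section Density

variable {N : ℕ} {a : Fin N → ℝ}

/-- The contribution of the `j`-th kernel to the density, up to a constant. -/
noncomputable def densityPiece (a : Fin N → ℝ) (j : ℕ) (x : ℝ) : ℝ :=
  (Ici (knot a 1)).indicator (fun x => ∫ s in kernelInterval a j ∩ Ioi x,
    shadowKernel a j s * (s - x) ^ ((N : ℝ) / 2 - 1 - 1)) x

lemma densityPiece_eq_zero_of_le {j : ℕ} {x : ℝ} (hx : knot a (N - 2 * j) ≤ x) :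
    densityPiece a j x = 0 := by
  have : kernelInterval a j ∩ Ioi x = ∅ := by
    ext s
    simp only [kernelInterval, mem_inter_iff, mem_Ioo, mem_Ioi, mem_empty_iff_false, iff_false]
    rintro ⟨⟨-, h1⟩, h2⟩
    linarith
  refine indicator_apply_eq_zero.2 fun _ => ?_
  rw [this, setIntegral_empty]

lemma densityPiece_eq_integral (ha : StrictMono a) {j : ℕ} (hj : 2 * j + 2 ≤ N) {x : ℝ}
    (h1 : knot a 1 ≤ x) (hx : x ≤ knot a (N - 2 * j - 1)) :
    densityPiece a j x =
      ∫ s in knot a (N - 2 * j - 1)..knot a (N - 2 * j), shadowIntegrand a j x s := by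
  have : kernelInterval a j ∩ Ioi x = kernelInterval a j :=
    inter_eq_left.2 fun s hs => hx.trans_lt hs.1
  rw [densityPiece, indicator_of_mem (mem_Ici.2 h1), this,
    intervalIntegral.integral_of_le (knot_le_knot ha (by omega) (by omega) (by omega)),
    integral_Ioc_eq_integral_Ioo]
  simp only [shadowIntegrand, show (N : ℝ) / 2 - 1 - 1 = N / 2 - 2 by ring]
  rfl

lemma densityPiece_eq_integral_of_mem {j : ℕ} {x : ℝ}
    (h1 : knot a 1 ≤ x) (hx : x ∈ Ico (knot a (N - 2 * j - 1)) (knot a (N - 2 * j))) :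
    densityPiece a j x = ∫ s in x..knot a (N - 2 * j), shadowIntegrand a j x s := by
  have : kernelInterval a j ∩ Ioi x = Ioo x (knot a (N - 2 * j)) := by
    ext s
    simp only [kernelInterval, mem_inter_iff, mem_Ioo, mem_Ioi]
    exact ⟨fun h => ⟨h.2, h.1.2⟩, fun h => ⟨⟨hx.1.trans_lt h.1, h.2⟩, h.1⟩⟩
  rw [densityPiece, indicator_of_mem (mem_Ici.2 h1), this,
    intervalIntegral.integral_of_le hx.2.le, integral_Ioc_eq_integral_Ioo]
  simp only [shadowIntegrand, show (N : ℝ) / 2 - 1 - 1 = N / 2 - 2 by ring]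

lemma sum_range_eq_of_eq_zero {f : ℕ → ℝ} {m n : ℕ} (hmn : m ≤ n)
    (h : ∀ j, m ≤ j → j < n → f j = 0) :
    ∑ j ∈ Finset.range n, f j = ∑ j ∈ Finset.range m, f j := by
  refine (Finset.sum_subset (Finset.range_mono hmn) fun j hj hj' => ?_).symm
  rw [Finset.mem_range] at hj hj'
  exact h j (by omega) hj

lemma shadowDensity_eq_zero (hN : 2 < N) (ha : StrictMono a) {x : ℝ}
    (hx : x ∉ Ico (knot a 1) (knot a N)) : shadowDensity a x = 0 := by
  have hout : ∀ i, 1 ≤ i → i < N → x ∉ Ico (knot a i) (knot a (i + 1)) := fun i h1 h2 h =>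
    hx ⟨(knot_le_knot ha le_rfl h1 h2.le).trans h.1,
      h.2.trans_le (knot_le_knot ha (by omega) h2 le_rfl)⟩
  rw [shadowDensity, Finset.sum_eq_zero, Finset.sum_eq_zero, add_zero]
  · intro M hM
    rw [Finset.mem_Icc] at hM
    have := hout (N - 2 * M - 1) (by omega) (by omega)
    rw [show N - 2 * M - 1 + 1 = N - 2 * M by omega] at this
    exact indicator_of_notMem this _
  · intro M hM
    rw [Finset.mem_Icc] at hM
    exact indicator_of_notMem (hout (N - 2 * M) (by omega) (by omega)) _

/-- The density as a signed sum of fractional integrals. -/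
theorem shadowDensity_eq_sum (hN : 2 < N) (ha : StrictMono a) (x : ℝ) :
    shadowDensity a x = ∑ j ∈ Finset.range (N / 2),
      ((N : ℝ) - 2) / (2 * Real.pi) * (-1) ^ j * densityPiece a j x := by
  by_cases hx : x ∈ Ico (knot a 1) (knot a N)
  swap
  · rw [shadowDensity_eq_zero hN ha hx, Finset.sum_eq_zero]
    intro j hj
    rw [Finset.mem_range] at hj
    rcases lt_or_ge x (knot a 1) with h | h
    · have hx1 : x ∉ Ici (knot a 1) := not_le.2 h
      rw [densityPiece, indicator_of_notMem hx1, mul_zero]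
    · have hxN : knot a N ≤ x := not_lt.1 fun h' => hx ⟨h, h'⟩
      rw [densityPiece_eq_zero_of_le ((knot_le_knot ha (by omega) (by omega) le_rfl).trans hxN),
        mul_zero]
  obtain ⟨i, h1, hi, hs⟩ := exists_knot_interval hx.1 (by omega : 1 ≤ N) hx.2
  have hout : ∀ i', 1 ≤ i' → i' < N → i' ≠ i → x ∉ Ico (knot a i') (knot a (i' + 1)) :=
    fun i' h1' h2' hne h => hne (knot_interval_unique ha h1' h2' h1 hi h hs)
  have houtE : ∀ M, 1 ≤ M → M ≤ (N - 1) / 2 → N - 2 * M ≠ i →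
      (Ico (knot a (N - 2 * M)) (knot a (N - 2 * M + 1))).indicator (evenFormula a M) x = 0 :=
    fun M h1' h2' hne => indicator_of_notMem (hout _ (by omega) (by omega) hne) _
  have houtO : ∀ M, M ≤ (N - 2) / 2 → N - 2 * M - 1 ≠ i →
      (Ico (knot a (N - 2 * M - 1)) (knot a (N - 2 * M))).indicator (oddFormula a M) x = 0 := by
    intro M h2' hne
    have := hout (N - 2 * M - 1) (by omega) (by omega) hne
    rw [show N - 2 * M - 1 + 1 = N - 2 * M by omega] at this
    exact indicator_of_notMem this _
  -- The parity of the number `N - i` of knots right of `x` selects the formula. Pieces with `j < M`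
  -- use the full interval and those lying left of `x` vanish; in the odd case the piece `j = M` is
  -- cut at `x`.
  rcases Nat.even_or_odd' (N - i) with ⟨M, hM | hM⟩
  · have e1 : N - 2 * M = i := by omega
    rw [shadowDensity, Finset.sum_eq_single M, Finset.sum_eq_zero, add_zero, e1,
      indicator_of_mem hs, evenFormula, Finset.mul_sum,
      sum_range_eq_of_eq_zero (f := fun j =>
        ((N : ℝ) - 2) / (2 * Real.pi) * (-1) ^ j * densityPiece a j x) (m := M) (by omega)]
    · refine Finset.sum_congr rfl fun j hj => ?_
      rw [Finset.mem_range] at hj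
      rw [densityPiece_eq_integral ha (by omega) hx.1, mul_assoc]
      exact hs.2.le.trans (knot_le_knot ha (by omega) (by omega) (by omega))
    · intro j hj1 hj2
      rw [densityPiece_eq_zero_of_le, mul_zero]
      exact (knot_le_knot ha (by omega) (by omega) (by omega)).trans hs.1
    · intro M' hM'
      rw [Finset.mem_Icc] at hM'
      exact houtO M' hM'.2 (by omega)
    · intro M' hM' hne
      rw [Finset.mem_Icc] at hM'
      exact houtE M' hM'.1 hM'.2 (by omega)
    · intro hM'
      rw [Finset.mem_Icc] at hM'
      omega
  · have e1 : N - 2 * M - 1 = i := by omega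
    have e2 : N - 2 * M = i + 1 := by omega
    have hs' : x ∈ Ico (knot a (N - 2 * M - 1)) (knot a (N - 2 * M)) := by rwa [e1, e2]
    rw [shadowDensity, Finset.sum_eq_zero, zero_add, Finset.sum_eq_single M,
      indicator_of_mem hs', oddFormula, Finset.mul_sum,
      sum_range_eq_of_eq_zero (f := fun j =>
        ((N : ℝ) - 2) / (2 * Real.pi) * (-1) ^ j * densityPiece a j x) (m := M + 1) (by omega),
      Finset.sum_range_succ]
    · congr 1
      · refine Finset.sum_congr rfl fun j hj => ?_
        rw [Finset.mem_range] at hj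
        rw [densityPiece_eq_integral ha (by omega) hx.1, mul_assoc]
        exact hs'.2.le.trans (knot_le_knot ha (by omega) (by omega) (by omega))
      · rw [densityPiece_eq_integral_of_mem hx.1 hs']
        ring
    · intro j hj1 hj2
      rw [densityPiece_eq_zero_of_le, mul_zero]
      exact (knot_le_knot ha (by omega) (by omega) (by omega)).trans hs'.1
    · intro M' hM' hne
      rw [Finset.mem_Icc] at hM'
      exact houtO M' hM'.2 (by omega)
    · intro hM'
      rw [Finset.mem_Icc] at hM'
      omega
    · intro M' hM'
      rw [Finset.mem_Icc] at hM'
      exact houtE M' hM'.1 hM'.2 (by omega)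

lemma densityPiece_integrable (hN : 2 < N) (ha : StrictMono a) {j : ℕ} (hj : 2 * j + 2 ≤ N) :
    Integrable (densityPiece a j) := by
  have hN' : (3 : ℝ) ≤ N := by exact_mod_cast hN
  have hlo : knot a 1 ≤ knot a (N - 2 * j - 1) := knot_le_knot ha le_rfl (by omega) (by omega)
  have hq : 0 < (N : ℝ) / 2 - 1 := by linarith
  have h := (integral_fractional_mul (α := knot a 1) (q := (N : ℝ) / 2 - 1)
    (S := kernelInterval a j) (measurableSet_kernelInterval a j) (measurable_shadowKernel a j)
    (w := fun _ => 1) (W := fun s => (s - knot a 1) ^ ((N : ℝ) / 2 - 1) / ((N : ℝ) / 2 - 1))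
    (fun s hs => by rw [shadowKernel_eq_gapProd ha hj hs]; exact gapProd_nonneg a s)
    measurable_const (fun _ _ _ _ => zero_le_one) (fun s hs => ?_)
    (integrableOn_shadowKernel_mul ha hj
      ((continuousOn_sub_rpow_of_nonneg hq.le _).div_const _))).1
  · simp only [mul_one] at h
    exact h
  · have hs1 : knot a 1 < s := hlo.trans_lt hs.1
    simp only [mul_one]
    exact ⟨integrableOn_sub_rpow hq hs1, integral_sub_rpow hq hs1⟩

/-- Fubini with weight `(z - x)^(-(q + 1))`, `q = N/2 - 1`, turns the fractional integral into a
Cauchy transform; the factor in `z` does not depend on `j`. -/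
lemma integral_densityPiece_mul (hN : 2 < N) (ha : StrictMono a) {j : ℕ} (hj : 2 * j + 2 ≤ N)
    {z : ℝ} (hz : knot a N < z) :
    Integrable (fun x => densityPiece a j x * (z - x) ^ (-((N : ℝ) / 2))) ∧
    ∫ x, densityPiece a j x * (z - x) ^ (-((N : ℝ) / 2)) =
      (((N : ℝ) / 2 - 1) * (z - knot a 1) ^ ((N : ℝ) / 2 - 1))⁻¹ *
        ∫ s in kernelInterval a j,
          shadowKernel a j s * ((s - knot a 1) ^ ((N : ℝ) / 2 - 1) / (z - s)) := by
  have hN' : (3 : ℝ) ≤ N := by exact_mod_cast hN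
  have hlo : knot a 1 ≤ knot a (N - 2 * j - 1) := knot_le_knot ha le_rfl (by omega) (by omega)
  have hhi : knot a (N - 2 * j) < z :=
    (knot_le_knot ha (by omega) (by omega) le_rfl).trans_lt hz
  set q : ℝ := (N : ℝ) / 2 - 1 with hq
  have hq0 : 0 < q := by rw [hq]; linarith
  have hq1 : (N : ℝ) / 2 = q + 1 := by rw [hq]; ring
  have hcont : ContinuousOn (fun s => (s - knot a 1) ^ q / (q * (z - s) * (z - knot a 1) ^ q))
      (Icc (knot a (N - 2 * j - 1)) (knot a (N - 2 * j))) := by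
    refine (continuousOn_sub_rpow_of_nonneg hq0.le _).div (by fun_prop) fun s hs => ?_
    have h1 : 0 < z - s := by linarith [hs.2]
    have h2 : 0 < z - knot a 1 := by linarith [hs.2, hs.1]
    positivity
  have h := integral_fractional_mul (α := knot a 1) (q := q)
    (S := kernelInterval a j) (measurableSet_kernelInterval a j) (measurable_shadowKernel a j)
    (w := fun x => (z - x) ^ (-(q + 1)))
    (W := fun s => (s - knot a 1) ^ q / (q * (z - s) * (z - knot a 1) ^ q))
    (fun s hs => by rw [shadowKernel_eq_gapProd ha hj hs]; exact gapProd_nonneg a s)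
    (by fun_prop) (fun s hs x hx => Real.rpow_nonneg (by linarith [hs.2, hx.2]) _)
    (fun s hs => integral_sub_rpow_mul_sub_rpow hq0 (hlo.trans_lt hs.1) (hs.2.trans hhi))
    (integrableOn_shadowKernel_mul ha hj hcont)
  rw [hq1]
  refine ⟨h.1, h.2.trans ?_⟩
  rw [← integral_const_mul]
  refine integral_congr_ae (Eventually.of_forall fun s => ?_)
  simp only [div_eq_mul_inv, mul_inv]
  ring

lemma integrable_shadowDensity (hN : 2 < N) (ha : StrictMono a) :
    Integrable (shadowDensity a) := by
  rw [show shadowDensity a = _ from funext (shadowDensity_eq_sum hN ha)]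
  refine integrable_finsetSum _ fun j hj => ?_
  rw [Finset.mem_range] at hj
  exact (densityPiece_integrable hN ha (by omega)).const_mul _

/-- The generalized Stieltjes transform of the density. -/
theorem integral_shadowDensity_mul (hN : 2 < N) (ha : StrictMono a) {z : ℝ}
    (hz : knot a N < z) :
    ∫ x, shadowDensity a x * (z - x) ^ (-((N : ℝ) / 2)) = ∏ i, (z - a i) ^ (-(1 / 2) : ℝ) := by
  have hN' : (3 : ℝ) ≤ N := by exact_mod_cast hN
  have hj : ∀ j ∈ Finset.range (N / 2), 2 * j + 2 ≤ N := fun j hj => by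
    rw [Finset.mem_range] at hj; omega
  simp_rw [shadowDensity_eq_sum hN ha, Finset.sum_mul, mul_assoc _ (densityPiece a _ _)]
  rw [integral_finsetSum _ fun j hj' =>
    (integral_densityPiece_mul hN ha (hj j hj') hz).1.const_mul _]
  have hz1 : 0 < z - knot a 1 :=
    sub_pos.2 ((knot_le_knot ha le_rfl (by omega) le_rfl).trans_lt hz)
  set q : ℝ := (N : ℝ) / 2 - 1 with hq
  have hq0 : 0 < q := by rw [hq]; linarith
  have hzq : (z - knot a 1) ^ q ≠ 0 := (Real.rpow_pos_of_pos hz1 _).ne'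
  calc _ = ((N : ℝ) - 2) / (2 * Real.pi) * (q * (z - knot a 1) ^ q)⁻¹ *
        ∑ j ∈ Finset.range (N / 2), (-1) ^ j * ∫ s in kernelInterval a j,
          shadowKernel a j s * ((s - knot a 1) ^ q / (z - s)) := by
        rw [Finset.mul_sum]
        refine Finset.sum_congr rfl fun j hj' => ?_
        rw [integral_const_mul, (integral_densityPiece_mul hN ha (hj j hj') hz).2]
        ring
    _ = _ := by
        have hsum := sum_integral_shadowKernel hN ha hz
        rw [← hq] at hsum
        -- Since `(N - 2)/(2π) = q/π`, the constant cancels `1/q`, the `π` of Cauchy's formula and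
        -- the powers of `z - a_1`.
        rw [hsum, show (N : ℝ) - 2 = 2 * q by rw [hq]; ring]
        have hpi := Real.pi_ne_zero
        field_simp

end Density

end ShadowDensity

theorem mainTheorem1 (N : ℕ) (hN : 2 < N) (a : Fin N → ℝ) (ha : StrictMono a)
    (A : Matrix (Fin N) (Fin N) ℝ) (hA : A.IsSymm) (hspec : spectrum ℝ A = Set.range a) :
    -- the real shadow is the law of the Dirichlet-weighted average, and `shadowDensity a`
    -- is its density
    realShadow A = dirichletAverage a (fun _ => 1 / 2) ∧
    IsDensityOf (shadowDensity a) (realShadow A) ∧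
    -- the integrals in the formulas converge absolutely, the only exception being
    -- `N = 3`, `x = a₂`
    (∀ M : ℕ, 1 ≤ M → M ≤ (N - 1) / 2 →
      ∀ x ∈ Set.Ico (knot a (N - 2 * M)) (knot a (N - 2 * M + 1)), ∀ j < M,
        IntervalIntegrable (shadowIntegrand a j x) volume
          (knot a (N - 2 * j - 1)) (knot a (N - 2 * j))) ∧
    (∀ M : ℕ, M ≤ (N - 2) / 2 →
      ∀ x ∈ Set.Ico (knot a (N - 2 * M - 1)) (knot a (N - 2 * M)),
        (∀ j < M, IntervalIntegrable (shadowIntegrand a j x) volume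
          (knot a (N - 2 * j - 1)) (knot a (N - 2 * j))) ∧
        (¬ (N = 3 ∧ x = knot a 2) → IntervalIntegrable (shadowIntegrand a M x) volume
          x (knot a (N - 2 * M)))) := by
  have hprob := isProbabilityMeasure_realShadow (A := A) (by omega : N ≠ 0)
  have hae := realShadow_ae_mem_Icc ha.injective hA hspec
    fun i => ⟨knot_one_le ha i, le_knot_self ha i⟩
  refine ⟨realShadow_eq_dirichletAverage (by omega) ha.injective hA hspec, ?_, ?_, ?_⟩
  · refine isDensityOf_of_integral_rpow_sub (knot_le_knot ha le_rfl (by omega) le_rfl) hae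
      (integrable_shadowDensity hN ha)
      (fun x hx => shadowDensity_eq_zero hN ha fun h => hx (Set.Ico_subset_Icc_self h))
      (p := (N : ℝ) / 2) (by positivity) fun z hz => ?_
    have hz' : ∀ i, a i < z := fun i => (le_knot_self ha i).trans_lt hz
    rw [integral_rpow_sub_eq_toReal hae hz,
      lintegral_realShadow (by omega) ha.injective hA hspec hz',
      integral_shadowDensity_mul hN ha hz,
      ENNReal.toReal_ofReal]
    exact Finset.prod_nonneg fun i _ => Real.rpow_nonneg (sub_pos.2 (hz' i)).le _
  · intro M hM1 hM2 x hx j hj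
    -- From `j < M`, `x < a_{N-2M+1} ≤ a_{N-2j-1}`, so `x` is strictly left of the interval of
    -- integration.
    exact intervalIntegrable_shadowIntegrand_of_lt ha (by omega)
      (hx.2.trans_le (knot_le_knot ha (by omega) (by omega) (by omega)))
  · intro M hM x hx
    refine ⟨fun j hj => ?_, fun hexc => ?_⟩
    · exact intervalIntegrable_shadowIntegrand_of_lt ha (by omega)
        (hx.2.trans_le (knot_le_knot ha (by omega) (by omega) (by omega)))
    · exact intervalIntegrable_shadowIntegrand_of_mem hN ha (by omega) hx hexc
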